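/- Let $\widetilde M$ be a Kähler manifold with Riemannian metric $g$, complex structure $J$ and Levi-Civita connection $\widetilde\nabla$, and let $M$ be a connected smooth surface (a submanifold of real dimension $2$, possibly only immersed) in $\widetilde M$, with the induced metric. Write $\nabla$ for the Levi-Civita connection of $M$, $\sigma$ for its second fundamental form, defined by $\widetilde\nabla_XY=\nabla_XY+\sigma(X,Y)$ for tangent vector fields $X,Y$ of $M$, and $H=\frac12\operatorname{tr}\sigma$ for its mean curvature vector. For a normal vector field $\xi$ let $-A_\xi X$ and $D_X\xi$ be the tangential and the normal component of $\widetilde\nabla_X\xi$, and let $f\xi$ be the normal component of $J\xi$. Suppose that - $M$ is totally real: $J\,T_pM\subset T_pM^\perp$ for every $p\in M$; - $M$ has commutative second fundamental forms: $A_\xi A_\eta=A_\eta A_\xi$ for all normal vector fields $\xi,\eta$; - the $f$-structure in the normal bundle is parallel: $D_X(f\xi)=f(D_X\xi)$ for all tangent vector fields $X$ and normal vector fields $\xi$ (this holds trivially if $f=0$); - the mean curvature vector is parallel: $D_XH=0$ for all tangent vector fields $X$. Then $M$ is flat (the curvature tensor of $\nabla$ vanishes identically) or totally geodesic ($\sigma=0$).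 -/

import Mathlib

open Bundle FiberBundle VectorField
open scoped Manifold ContDiff

namespace TotReal

noncomputable section

/-! ### The Levi-Civita connection of a Riemannian manifold -/

section LeviCivita

variable {E : Type*} [NormedAddCommGroup E] [NormedSpace ℝ E]
  {M : Type*} [TopologicalSpace M] [ChartedSpace E M]

instance tangentSpace_finiteDimensional [FiniteDimensional ℝ E] (x : M) :
    FiniteDimensional ℝ (TangentSpace 𝓘(ℝ, E) x) :=
  inferInstanceAs (FiniteDimensional ℝ E)

variable [RiemannianBundle (fun x : M ↦ TangentSpace 𝓘(ℝ, E) x)]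

instance tangentSpace_completeSpace [FiniteDimensional ℝ E] (x : M) :
    CompleteSpace (TangentSpace 𝓘(ℝ, E) x) :=
  FiniteDimensional.complete ℝ _

/-- The Koszul expression
`X⟨Y, Z⟩ + Y⟨X, Z⟩ - Z⟨X, Y⟩ + ⟨[X, Y], Z⟩ - ⟨[X, Z], Y⟩ - ⟨[Y, Z], X⟩` at the point `x`. -/
def koszul (X Y Z : Π x : M, TangentSpace 𝓘(ℝ, E) x) (x : M) : ℝ :=
  mvfderiv 𝓘(ℝ, E) (fun y ↦ inner ℝ (Y y) (Z y)) x (X x)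
  + mvfderiv 𝓘(ℝ, E) (fun y ↦ inner ℝ (X y) (Z y)) x (Y x)
  - mvfderiv 𝓘(ℝ, E) (fun y ↦ inner ℝ (X y) (Y y)) x (Z x)
  + inner ℝ (mlieBracket 𝓘(ℝ, E) X Y x) (Z x)
  - inner ℝ (mlieBracket 𝓘(ℝ, E) X Z x) (Y x)
  - inner ℝ (mlieBracket 𝓘(ℝ, E) Y Z x) (X x)

theorem mvfderiv_inner_comm (x : M) (X Y : Π x : M, TangentSpace 𝓘(ℝ, E) x) :
    mvfderiv 𝓘(ℝ, E) (fun y ↦ inner ℝ (X y) (Y y)) x =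
      mvfderiv 𝓘(ℝ, E) (fun y ↦ inner ℝ (Y y) (X y)) x := by
  simp only [real_inner_comm]

theorem koszul_sub_swap (x : M) (X Y Z : Π x : M, TangentSpace 𝓘(ℝ, E) x) :
    koszul X Y Z x - koszul Y X Z x = 2 * inner ℝ (mlieBracket 𝓘(ℝ, E) X Y x) (Z x) := by
  have h : mlieBracket 𝓘(ℝ, E) Y X x = - mlieBracket 𝓘(ℝ, E) X Y x := mlieBracket_swap_apply
  unfold koszul
  rw [mvfderiv_inner_comm x Y X, h, inner_neg_left]
  ring

theorem koszul_add_swap (x : M) (X Y Z : Π x : M, TangentSpace 𝓘(ℝ, E) x) :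
    koszul X Y Z x + koszul X Z Y x =
      2 * mvfderiv 𝓘(ℝ, E) (fun y ↦ inner ℝ (Y y) (Z y)) x (X x) := by
  have h : mlieBracket 𝓘(ℝ, E) Z Y x = - mlieBracket 𝓘(ℝ, E) Y Z x := mlieBracket_swap_apply
  unfold koszul
  rw [mvfderiv_inner_comm x Z Y, h, inner_neg_left]
  ring

variable [IsManifold 𝓘(ℝ, E) ∞ M]
  [IsContMDiffRiemannianBundle 𝓘(ℝ, E) ∞ E (fun x : M ↦ TangentSpace 𝓘(ℝ, E) x)]

theorem mdifferentiableAt_inner {x : M} {Y Z : Π x : M, TangentSpace 𝓘(ℝ, E) x}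
    (hY : MDiffAt (T% Y) x) (hZ : MDiffAt (T% Z) x) :
    MDifferentiableAt 𝓘(ℝ, E) 𝓘(ℝ, ℝ) (fun y ↦ inner ℝ (Y y) (Z y)) x :=
  MDifferentiableAt.inner_bundle (F := E) (E := fun x : M ↦ TangentSpace 𝓘(ℝ, E) x) hY hZ

theorem mvfderiv_inner_add {x : M} {X X' Y : Π x : M, TangentSpace 𝓘(ℝ, E) x}
    (hX : MDiffAt (T% X) x) (hX' : MDiffAt (T% X') x) (hY : MDiffAt (T% Y) x) :
    mvfderiv 𝓘(ℝ, E) (fun y ↦ inner ℝ ((X + X') y) (Y y)) x =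
      mvfderiv 𝓘(ℝ, E) (fun y ↦ inner ℝ (X y) (Y y)) x
        + mvfderiv 𝓘(ℝ, E) (fun y ↦ inner ℝ (X' y) (Y y)) x := by
  rw [← mvfderiv_fun_add (mdifferentiableAt_inner hX hY) (mdifferentiableAt_inner hX' hY)]
  simp only [Pi.add_apply, inner_add_left]

theorem mvfderiv_inner_smul {x : M} {f : M → ℝ} {X Y : Π x : M, TangentSpace 𝓘(ℝ, E) x}
    (hf : MDiffAt f x) (hX : MDiffAt (T% X) x) (hY : MDiffAt (T% Y) x) :
    mvfderiv 𝓘(ℝ, E) (fun y ↦ inner ℝ ((f • X) y) (Y y)) x =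
      f x • mvfderiv 𝓘(ℝ, E) (fun y ↦ inner ℝ (X y) (Y y)) x
        + (inner ℝ (X x) (Y x) : ℝ) • mvfderiv 𝓘(ℝ, E) f x := by
  rw [← mvfderiv_fun_mul hf (mdifferentiableAt_inner hX hY)]
  simp only [Pi.smul_apply', inner_smul_left, RCLike.conj_to_real]

variable [FiniteDimensional ℝ E]

theorem koszul_tensorial_left {x : M} {Y Z : Π x : M, TangentSpace 𝓘(ℝ, E) x}
    (hY : MDiffAt (T% Y) x) (hZ : MDiffAt (T% Z) x) :
    TensorialAt 𝓘(ℝ, E) E (fun X ↦ koszul X Y Z x) x where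
  smul {f X} hf hX := by
    unfold koszul
    rw [mvfderiv_inner_smul hf hX hY, mvfderiv_inner_smul hf hX hZ]
    simp only [mlieBracket_smul_left hf hX, Pi.smul_apply', map_smul, inner_add_left,
      inner_smul_left, inner_smul_right, RCLike.conj_to_real, smul_eq_mul, add_apply, smul_apply]
    rw [real_inner_comm (Y x) (X x), real_inner_comm (Z x) (X x)]
    ring
  add {X X'} hX hX' := by
    unfold koszul
    rw [mvfderiv_inner_add hX hX' hY, mvfderiv_inner_add hX hX' hZ]
    simp only [mlieBracket_add_left hX hX', Pi.add_apply, map_add, inner_add_left,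
      inner_add_right, add_apply]
    ring

theorem koszul_tensorial_right {x : M} {X Y : Π x : M, TangentSpace 𝓘(ℝ, E) x}
    (hX : MDiffAt (T% X) x) (hY : MDiffAt (T% Y) x) :
    TensorialAt 𝓘(ℝ, E) E (fun Z ↦ koszul X Y Z x) x where
  smul {f Z} hf hZ := by
    unfold koszul
    rw [mvfderiv_inner_comm x X (f • Z), mvfderiv_inner_comm x Y (f • Z),
      mvfderiv_inner_smul hf hZ hY, mvfderiv_inner_smul hf hZ hX,
      mvfderiv_inner_comm x Z Y, mvfderiv_inner_comm x Z X]
    simp only [mlieBracket_smul_right hf hZ, Pi.smul_apply', map_smul, inner_add_left,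
      inner_smul_left, inner_smul_right, RCLike.conj_to_real, smul_eq_mul, add_apply, smul_apply]
    ring
  add {Z Z'} hZ hZ' := by
    unfold koszul
    rw [mvfderiv_inner_comm x X (Z + Z'), mvfderiv_inner_comm x Y (Z + Z'),
      mvfderiv_inner_add hZ hZ' hX, mvfderiv_inner_add hZ hZ' hY,
      mvfderiv_inner_comm x Z Y, mvfderiv_inner_comm x Z X,
      mvfderiv_inner_comm x Z' Y, mvfderiv_inner_comm x Z' X]
    simp only [mlieBracket_add_right hZ hZ', Pi.add_apply, map_add, inner_add_left,
      inner_add_right, add_apply]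
    ring

theorem koszul_add_middle {x : M} {X Y Y' Z : Π x : M, TangentSpace 𝓘(ℝ, E) x}
    (hX : MDiffAt (T% X) x) (hY : MDiffAt (T% Y) x) (hY' : MDiffAt (T% Y') x)
    (hZ : MDiffAt (T% Z) x) :
    koszul X (Y + Y') Z x = koszul X Y Z x + koszul X Y' Z x := by
  unfold koszul
  rw [mvfderiv_inner_comm x X (Y + Y'), mvfderiv_inner_add hY hY' hX,
    mvfderiv_inner_add hY hY' hZ, mvfderiv_inner_comm x Y X, mvfderiv_inner_comm x Y' X]
  simp only [mlieBracket_add_right hY hY', mlieBracket_add_left hY hY', Pi.add_apply, map_add,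
    inner_add_left, inner_add_right, add_apply]
  ring

theorem koszul_smul_middle {x : M} {f : M → ℝ} {X Y Z : Π x : M, TangentSpace 𝓘(ℝ, E) x}
    (hf : MDiffAt f x) (hX : MDiffAt (T% X) x) (hY : MDiffAt (T% Y) x)
    (hZ : MDiffAt (T% Z) x) :
    koszul X (f • Y) Z x =
      f x * koszul X Y Z x + 2 * (mvfderiv 𝓘(ℝ, E) f x (X x) * inner ℝ (Y x) (Z x)) := by
  unfold koszul
  rw [mvfderiv_inner_comm x X (f • Y), mvfderiv_inner_smul hf hY hX,
    mvfderiv_inner_smul hf hY hZ, mvfderiv_inner_comm x Y X]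
  simp only [mlieBracket_smul_right hf hY, mlieBracket_smul_left hf hY, Pi.smul_apply', map_smul,
    inner_add_left, inner_smul_left, inner_smul_right, RCLike.conj_to_real, smul_eq_mul,
    add_apply, smul_apply]
  rw [real_inner_comm (Z x) (Y x), real_inner_comm (X x) (Y x)]
  ring

open Classical in
/-- The Koszul expression of `Y` at `x`, as a bilinear form in the values of `X` and `Z` at `x`
(and `0` if `Y` is not differentiable at `x`). -/
def koszulForm (Y : Π x : M, TangentSpace 𝓘(ℝ, E) x) (x : M) :
    TangentSpace 𝓘(ℝ, E) x →L[ℝ] TangentSpace 𝓘(ℝ, E) x →L[ℝ] ℝ :=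
  if hY : MDiffAt (T% Y) x then
    TensorialAt.mkHom₂ (V := TangentSpace 𝓘(ℝ, E)) (V' := TangentSpace 𝓘(ℝ, E))
      (fun X Z ↦ koszul X Y Z x) x
      (fun _ hZ ↦ koszul_tensorial_left hY hZ) (fun _ hX ↦ koszul_tensorial_right hX hY)
  else 0

theorem koszulForm_apply {x : M} {X Y Z : Π x : M, TangentSpace 𝓘(ℝ, E) x}
    (hX : MDiffAt (T% X) x) (hY : MDiffAt (T% Y) x) (hZ : MDiffAt (T% Z) x) :
    koszulForm Y x (X x) (Z x) = koszul X Y Z x := by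
  rw [koszulForm, dif_pos hY]
  exact TensorialAt.mkHom₂_apply (V := TangentSpace 𝓘(ℝ, E)) (V' := TangentSpace 𝓘(ℝ, E))
    _ _ hX hZ

/-- The map `u ↦ ∇_u Y` at `x`, given by the Koszul formula. -/
def leviCivitaFun (Y : Π x : M, TangentSpace 𝓘(ℝ, E) x) (x : M) :
    TangentSpace 𝓘(ℝ, E) x →L[ℝ] TangentSpace 𝓘(ℝ, E) x :=
  LinearMap.toContinuousLinearMap
    { toFun u := (1 / 2 : ℝ) •
        (InnerProductSpace.toDual ℝ (TangentSpace 𝓘(ℝ, E) x)).symm (koszulForm Y x u)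
      map_add' u v := by simp
      map_smul' c u := by
        rw [map_smul, LinearIsometryEquiv.map_smulₛₗ, RCLike.conj_to_real, RingHom.id_apply,
          smul_comm] }

theorem inner_leviCivitaFun {x : M} {X Y Z : Π x : M, TangentSpace 𝓘(ℝ, E) x}
    (hX : MDiffAt (T% X) x) (hY : MDiffAt (T% Y) x) (hZ : MDiffAt (T% Z) x) :
    2 * inner ℝ (leviCivitaFun Y x (X x)) (Z x) = koszul X Y Z x := by
  rw [← koszulForm_apply hX hY hZ]
  simp [leviCivitaFun, inner_smul_left]

/-- The Levi-Civita connection; `leviCivita Y x u` is `∇_u Y` at `x`. -/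
def leviCivita : CovariantDerivative 𝓘(ℝ, E) E (TangentSpace 𝓘(ℝ, E) : M → Type _) where
  toFun := leviCivitaFun
  isCovariantDerivativeOnUniv :=
  { add := by
      intro Y Y' x hY hY' _
      ext u
      refine ext_inner_right ℝ fun w ↦ ?_
      have hX := mdifferentiableAt_extend 𝓘(ℝ, E) E u
      have hZ := mdifferentiableAt_extend 𝓘(ℝ, E) E w
      have h1 := inner_leviCivitaFun hX hY hZ
      have h2 := inner_leviCivitaFun hX hY' hZ
      have h3 := inner_leviCivitaFun hX (mdifferentiableAt_add_section hY hY') hZ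
      rw [koszul_add_middle hX hY hY' hZ] at h3
      simp only [extend_apply_self] at h1 h2 h3
      rw [add_apply, inner_add_left]
      linarith
    leibniz := by
      intro Y f x hY hf _
      ext u
      refine ext_inner_right ℝ fun w ↦ ?_
      have hX := mdifferentiableAt_extend 𝓘(ℝ, E) E u
      have hZ := mdifferentiableAt_extend 𝓘(ℝ, E) E w
      have h1 := inner_leviCivitaFun hX hY hZ
      have h3 := inner_leviCivitaFun hX (hf.smul_section hY) hZ
      rw [koszul_smul_middle hf hX hY hZ] at h3
      simp only [extend_apply_self] at h1 h3
      rw [add_apply, inner_add_left, smul_apply, inner_smul_left,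
        ContinuousLinearMap.smulRight_apply, inner_smul_left]
      simp only [RCLike.conj_to_real]
      rw [← h1] at h3
      linarith }

theorem inner_leviCivita {x : M} {X Y Z : Π x : M, TangentSpace 𝓘(ℝ, E) x}
    (hX : MDiffAt (T% X) x) (hY : MDiffAt (T% Y) x) (hZ : MDiffAt (T% Z) x) :
    2 * inner ℝ (leviCivita Y x (X x)) (Z x) = koszul X Y Z x :=
  inner_leviCivitaFun hX hY hZ

/-- The Levi-Civita connection is torsion-free. -/
theorem leviCivita_torsion {x : M} {X Y : Π x : M, TangentSpace 𝓘(ℝ, E) x}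
    (hX : MDiffAt (T% X) x) (hY : MDiffAt (T% Y) x) :
    leviCivita Y x (X x) - leviCivita X x (Y x) = mlieBracket 𝓘(ℝ, E) X Y x := by
  refine ext_inner_right ℝ fun w ↦ ?_
  have hZ := mdifferentiableAt_extend 𝓘(ℝ, E) E w
  have h1 := inner_leviCivita hX hY hZ
  have h2 := inner_leviCivita hY hX hZ
  have h3 := koszul_sub_swap x X Y (extend E w)
  simp only [extend_apply_self] at h1 h2 h3
  rw [inner_sub_left]
  linarith

/-- The Levi-Civita connection is compatible with the metric. -/
theorem leviCivita_metric {x : M} {X Y Z : Π x : M, TangentSpace 𝓘(ℝ, E) x}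
    (hX : MDiffAt (T% X) x) (hY : MDiffAt (T% Y) x) (hZ : MDiffAt (T% Z) x) :
    mvfderiv 𝓘(ℝ, E) (fun y ↦ inner ℝ (Y y) (Z y)) x (X x) =
      inner ℝ (leviCivita Y x (X x)) (Z x) + inner ℝ (Y x) (leviCivita Z x (X x)) := by
  have h1 := inner_leviCivita hX hY hZ
  have h2 := inner_leviCivita hX hZ hY
  have h3 := koszul_add_swap x X Y Z
  rw [real_inner_comm (leviCivita Z x (X x)) (Y x)] at *
  linarith

end LeviCivita

/-- A Riemannian manifold is flat if the curvature
`R(X, Y)Z = ∇_X ∇_Y Z - ∇_Y ∇_X Z - ∇_[X, Y] Z` of its Levi-Civita connection vanishes. -/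
def IsFlat (E : Type*) [NormedAddCommGroup E] [NormedSpace ℝ E] [FiniteDimensional ℝ E]
    (M : Type*) [TopologicalSpace M] [ChartedSpace E M] [IsManifold 𝓘(ℝ, E) ∞ M]
    [RiemannianBundle (fun x : M ↦ TangentSpace 𝓘(ℝ, E) x)]
    [IsContMDiffRiemannianBundle 𝓘(ℝ, E) ∞ E (fun x : M ↦ TangentSpace 𝓘(ℝ, E) x)] : Prop :=
  ∀ X Y Z : Π x : M, TangentSpace 𝓘(ℝ, E) x,
    ContMDiff 𝓘(ℝ, E) (𝓘(ℝ, E).prod 𝓘(ℝ, E)) ∞ (fun x ↦ (⟨x, X x⟩ : TangentBundle 𝓘(ℝ, E) M)) →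
    ContMDiff 𝓘(ℝ, E) (𝓘(ℝ, E).prod 𝓘(ℝ, E)) ∞ (fun x ↦ (⟨x, Y x⟩ : TangentBundle 𝓘(ℝ, E) M)) →
    ContMDiff 𝓘(ℝ, E) (𝓘(ℝ, E).prod 𝓘(ℝ, E)) ∞ (fun x ↦ (⟨x, Z x⟩ : TangentBundle 𝓘(ℝ, E) M)) →
    ∀ p : M,
      leviCivita (fun x ↦ leviCivita Z x (Y x)) p (X p)
        - leviCivita (fun x ↦ leviCivita Z x (X x)) p (Y p)
        - leviCivita Z p (mlieBracket 𝓘(ℝ, E) X Y p) = 0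

/-- `J` makes the Riemannian manifold `N` a Kähler manifold: it is a smooth almost complex
structure which is orthogonal for the metric and parallel for the Levi-Civita connection (such a
`J` is integrable). -/
structure IsKahler {E' : Type*} [NormedAddCommGroup E'] [NormedSpace ℝ E'] [FiniteDimensional ℝ E']
    {N : Type*} [TopologicalSpace N] [ChartedSpace E' N] [IsManifold 𝓘(ℝ, E') ∞ N]
    [RiemannianBundle (fun y : N ↦ TangentSpace 𝓘(ℝ, E') y)]
    [IsContMDiffRiemannianBundle 𝓘(ℝ, E') ∞ E' (fun y : N ↦ TangentSpace 𝓘(ℝ, E') y)]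
    (J : Π y : N, TangentSpace 𝓘(ℝ, E') y →L[ℝ] TangentSpace 𝓘(ℝ, E') y) : Prop where
  contMDiff : ContMDiff 𝓘(ℝ, E') (𝓘(ℝ, E').prod 𝓘(ℝ, E' →L[ℝ] E')) ∞
    (fun y ↦ (TotalSpace.mk' (E' →L[ℝ] E') y (J y) : TotalSpace (E' →L[ℝ] E')
      (fun y : N ↦ TangentSpace 𝓘(ℝ, E') y →L[ℝ] TangentSpace 𝓘(ℝ, E') y)))
  sq : ∀ (y : N) (v : TangentSpace 𝓘(ℝ, E') y), J y (J y v) = -v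
  inner_map : ∀ (y : N) (v w : TangentSpace 𝓘(ℝ, E') y),
    (inner ℝ (J y v) (J y w) : ℝ) = inner ℝ v w
  parallel : ∀ (y : N) (Y : Π y : N, TangentSpace 𝓘(ℝ, E') y),
    MDifferentiableAt 𝓘(ℝ, E') (𝓘(ℝ, E').prod 𝓘(ℝ, E'))
      (fun z ↦ (⟨z, Y z⟩ : TangentBundle 𝓘(ℝ, E') N)) y →
    ∀ v : TangentSpace 𝓘(ℝ, E') y,
      leviCivita (fun z ↦ J z (Y z)) y v = J y (leviCivita Y y v)

/-! ### Isometrically immersed submanifolds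

Throughout, `F : M → N` is the immersion, and a vector field along `F` is a family of vectors
`V x` tangent to `N` at `F x`. -/

section Submanifold

variable (E : Type*) [NormedAddCommGroup E] [NormedSpace ℝ E]
  {M : Type*} [TopologicalSpace M] [ChartedSpace E M]
  (E' : Type*) [NormedAddCommGroup E'] [NormedSpace ℝ E']
  {N : Type*} [TopologicalSpace N] [ChartedSpace E' N]

variable [RiemannianBundle (fun x : M ↦ TangentSpace 𝓘(ℝ, E) x)]
  [RiemannianBundle (fun y : N ↦ TangentSpace 𝓘(ℝ, E') y)]

/-- `F` is a smooth isometric immersion: it is smooth, and the metric of `M` is induced by `F`. -/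
structure IsIsometricImmersion (F : M → N) : Prop where
  contMDiff : ContMDiff 𝓘(ℝ, E) 𝓘(ℝ, E') ∞ F
  inner_map : ∀ (p : M) (u v : TangentSpace 𝓘(ℝ, E) p),
    (inner ℝ (mfderiv 𝓘(ℝ, E) 𝓘(ℝ, E') F p u) (mfderiv 𝓘(ℝ, E) 𝓘(ℝ, E') F p v) : ℝ)
      = inner ℝ u v

/-- `M` is totally real: `J` maps each tangent space of `M` into the normal space. -/
def IsTotallyReal (F : M → N)
    (J : Π y : N, TangentSpace 𝓘(ℝ, E') y →L[ℝ] TangentSpace 𝓘(ℝ, E') y) : Prop :=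
  ∀ (p : M) (u v : TangentSpace 𝓘(ℝ, E) p),
    (inner ℝ (J (F p) (mfderiv 𝓘(ℝ, E) 𝓘(ℝ, E') F p u)) (mfderiv 𝓘(ℝ, E) 𝓘(ℝ, E') F p v) : ℝ) = 0

variable [IsManifold 𝓘(ℝ, E') ∞ N]

/-- `ξ` is a smooth normal vector field of `M`. -/
structure IsNormalField (F : M → N) (ξ : Π x : M, TangentSpace 𝓘(ℝ, E') (F x)) : Prop where
  contMDiff : ContMDiff 𝓘(ℝ, E) (𝓘(ℝ, E').prod 𝓘(ℝ, E')) ∞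
    (fun x ↦ (⟨F x, ξ x⟩ : TangentBundle 𝓘(ℝ, E') N))
  normal : ∀ (p : M) (u : TangentSpace 𝓘(ℝ, E) p),
    (inner ℝ (mfderiv 𝓘(ℝ, E) 𝓘(ℝ, E') F p u) (ξ p) : ℝ) = 0

variable [FiniteDimensional ℝ E] [FiniteDimensional ℝ E']

/-- The tangential component of a vector of `N` at `F p`, as a tangent vector of `M` at `p`. It is
the adjoint of the differential; since the latter is isometric, it is characterized by
`tangentPart_mfderiv` and `tangentPart_eq_zero`. -/
def tangentPart (F : M → N) (p : M) :
    TangentSpace 𝓘(ℝ, E') (F p) →L[ℝ] TangentSpace 𝓘(ℝ, E) p :=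
  ContinuousLinearMap.adjoint (mfderiv 𝓘(ℝ, E) 𝓘(ℝ, E') F p)

theorem tangentPart_mfderiv {F : M → N} (hF : IsIsometricImmersion E E' F) (p : M)
    (u : TangentSpace 𝓘(ℝ, E) p) :
    tangentPart E E' F p (mfderiv 𝓘(ℝ, E) 𝓘(ℝ, E') F p u) = u := by
  refine ext_inner_right ℝ fun w ↦ ?_
  rw [tangentPart, ContinuousLinearMap.adjoint_inner_left, hF.inner_map]

theorem tangentPart_eq_zero (F : M → N) (p : M) (ξ : TangentSpace 𝓘(ℝ, E') (F p))
    (h : ∀ u : TangentSpace 𝓘(ℝ, E) p,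
      (inner ℝ (mfderiv 𝓘(ℝ, E) 𝓘(ℝ, E') F p u) ξ : ℝ) = 0) :
    tangentPart E E' F p ξ = 0 := by
  refine ext_inner_right ℝ fun w ↦ ?_
  rw [tangentPart, ContinuousLinearMap.adjoint_inner_left, real_inner_comm, h, inner_zero_left]

/-- The normal component of a vector of `N` at `F p`. -/
def normalPart (F : M → N) (p : M) :
    TangentSpace 𝓘(ℝ, E') (F p) →L[ℝ] TangentSpace 𝓘(ℝ, E') (F p) :=
  ContinuousLinearMap.id ℝ _ - mfderiv 𝓘(ℝ, E) 𝓘(ℝ, E') F p ∘L tangentPart E E' F p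

theorem inner_normalPart {F : M → N} (hF : IsIsometricImmersion E E' F) (p : M)
    (u : TangentSpace 𝓘(ℝ, E) p) (v : TangentSpace 𝓘(ℝ, E') (F p)) :
    (inner ℝ (mfderiv 𝓘(ℝ, E) 𝓘(ℝ, E') F p u) (normalPart E E' F p v) : ℝ) = 0 := by
  rw [normalPart, sub_apply, inner_sub_right, ContinuousLinearMap.comp_apply, hF.inner_map,
    tangentPart, ContinuousLinearMap.adjoint_inner_right]
  simp

variable [IsContMDiffRiemannianBundle 𝓘(ℝ, E') ∞ E' (fun y : N ↦ TangentSpace 𝓘(ℝ, E') y)]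

/-- The covariant derivative `u ↦ ∇̃_u V` of a vector field `V` along `F` at `p`, induced by the
Levi-Civita connection of `N`. In the trivialization `e` of the tangent bundle of `N` around
`F p`, with `V` given by the function `x ↦ (e ⟨F x, V x⟩).2`, it is the derivative of this function
plus the derivative in the direction `dF u` of the section of constant coordinates through
`V p`. -/
def covAlong (F : M → N) (V : Π x : M, TangentSpace 𝓘(ℝ, E') (F x)) (p : M) :
    TangentSpace 𝓘(ℝ, E) p →L[ℝ] TangentSpace 𝓘(ℝ, E') (F p) :=
  (trivializationAt E' (TangentSpace 𝓘(ℝ, E')) (F p)).symmL ℝ (F p) ∘L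
      mvfderiv 𝓘(ℝ, E)
        (fun x ↦ (trivializationAt E' (TangentSpace 𝓘(ℝ, E')) (F p) ⟨F x, V x⟩).2) p
    + leviCivita (extend E' (V p)) (F p) ∘L mfderiv 𝓘(ℝ, E) 𝓘(ℝ, E') F p

/-- The coordinates of the vector field `W` in the trivialization of the tangent bundle
around `q`. -/
def coordAt (q : N) (W : Π y : N, TangentSpace 𝓘(ℝ, E') y) (y : N) : E' :=
  (trivializationAt E' (TangentSpace 𝓘(ℝ, E')) q ⟨y, W y⟩).2

theorem mvfderiv_congr {f g : N → E'} {q : N} (h : f =ᶠ[nhds q] g) :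
    mvfderiv 𝓘(ℝ, E') f q = mvfderiv 𝓘(ℝ, E') g q := by
  ext u
  have h1 : mfderiv 𝓘(ℝ, E') 𝓘(ℝ, E') f q = mfderiv 𝓘(ℝ, E') 𝓘(ℝ, E') g q := h.mfderiv_eq
  exact congrArg (fun L : E' →L[ℝ] E' ↦ L u) h1

theorem tensorial_coordAt (q : N) :
    TensorialAt 𝓘(ℝ, E') E' (fun W : Π y : N, TangentSpace 𝓘(ℝ, E') y ↦
      leviCivita W q - (trivializationAt E' (TangentSpace 𝓘(ℝ, E')) q).symmL ℝ q ∘L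
        mvfderiv 𝓘(ℝ, E') (coordAt E' q W) q) q where
  smul {f W} hf hW := by
    have hq := FiberBundle.mem_baseSet_trivializationAt' (F := E') (E := TangentSpace 𝓘(ℝ, E')) q
    have h : coordAt E' q (f • W) =ᶠ[nhds q] f • coordAt E' q W := by
      filter_upwards [(trivializationAt E' (TangentSpace 𝓘(ℝ, E')) q).open_baseSet.mem_nhds hq]
        with y hy
      exact ((trivializationAt E' (TangentSpace 𝓘(ℝ, E')) q).linear ℝ hy).map_smul (f y) (W y)
    have hc : MDifferentiableAt 𝓘(ℝ, E') 𝓘(ℝ, E') (coordAt E' q W) q :=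
      (mdifferentiableAt_section 𝓘(ℝ, E') W).1 hW
    rw [mvfderiv_congr E' h, mvfderiv_smul hf hc, leviCivita.isCovariantDerivativeOn.leibniz hW hf]
    have h2 : (trivializationAt E' (TangentSpace 𝓘(ℝ, E')) q).symmL ℝ q (coordAt E' q W q) = W q := by
      have := (trivializationAt E' (TangentSpace 𝓘(ℝ, E')) q).symmL_continuousLinearMapAt
        (R := ℝ) hq (W q)
      rwa [(trivializationAt E' (TangentSpace 𝓘(ℝ, E')) q).continuousLinearMapAt_apply_of_mem ℝ hq]
        at this
    ext u
    simp [h2, smul_sub]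
  add {W W'} hW hW' := by
    have hq := FiberBundle.mem_baseSet_trivializationAt' (F := E') (E := TangentSpace 𝓘(ℝ, E')) q
    have h : coordAt E' q (W + W') =ᶠ[nhds q] coordAt E' q W + coordAt E' q W' := by
      filter_upwards [(trivializationAt E' (TangentSpace 𝓘(ℝ, E')) q).open_baseSet.mem_nhds hq]
        with y hy
      exact ((trivializationAt E' (TangentSpace 𝓘(ℝ, E')) q).linear ℝ hy).map_add (W y) (W' y)
    have hc : MDifferentiableAt 𝓘(ℝ, E') 𝓘(ℝ, E') (coordAt E' q W) q :=
      (mdifferentiableAt_section 𝓘(ℝ, E') W).1 hW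
    have hc' : MDifferentiableAt 𝓘(ℝ, E') 𝓘(ℝ, E') (coordAt E' q W') q :=
      (mdifferentiableAt_section 𝓘(ℝ, E') W').1 hW'
    rw [mvfderiv_congr E' h, mvfderiv_add hc hc', leviCivita.isCovariantDerivativeOn.add hW hW']
    ext u
    simp
    abel

/-- The covariant derivative along `F` restricts to `∇̃` on vector fields of `N`. -/
theorem covAlong_comp (F : M → N) (p : M) (hF : MDifferentiableAt 𝓘(ℝ, E) 𝓘(ℝ, E') F p)
    (W : Π y : N, TangentSpace 𝓘(ℝ, E') y) (hW : MDiffAt (T% W) (F p)) :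
    covAlong E E' F (fun x ↦ W (F x)) p =
      leviCivita W (F p) ∘L mfderiv 𝓘(ℝ, E) 𝓘(ℝ, E') F p := by
  have hq := FiberBundle.mem_baseSet_trivializationAt' (F := E') (E := TangentSpace 𝓘(ℝ, E')) (F p)
  have key := (tensorial_coordAt E' (F p)).pointwise hW
    (mdifferentiableAt_extend 𝓘(ℝ, E') E' (W (F p))) (extend_apply_self (F := E') (W (F p))).symm
  have h : coordAt E' (F p) (extend E' (W (F p))) =ᶠ[nhds (F p)]
      fun _ ↦ (trivializationAt E' (TangentSpace 𝓘(ℝ, E')) (F p) ⟨F p, W (F p)⟩).2 := by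
    filter_upwards [(trivializationAt E' (TangentSpace 𝓘(ℝ, E')) (F p)).open_baseSet.mem_nhds hq]
      with y hy
    have h1 := congrArg Prod.snd
      ((trivializationAt E' (TangentSpace 𝓘(ℝ, E')) (F p)).apply_mk_symm hy
        (trivializationAt E' (TangentSpace 𝓘(ℝ, E')) (F p) ⟨F p, W (F p)⟩).2)
    exact h1
  rw [mvfderiv_congr E' h, mvfderiv_const, ContinuousLinearMap.comp_zero, sub_zero] at key
  have hc : MDifferentiableAt 𝓘(ℝ, E') 𝓘(ℝ, E') (coordAt E' (F p) W) (F p) :=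
    (mdifferentiableAt_section 𝓘(ℝ, E') W).1 hW
  have h3 : mvfderiv 𝓘(ℝ, E) (coordAt E' (F p) W ∘ F) p =
      mvfderiv 𝓘(ℝ, E') (coordAt E' (F p) W) (F p) ∘L mfderiv 𝓘(ℝ, E) 𝓘(ℝ, E') F p :=
    mfderiv_comp p hc hF
  have h4 : (fun x ↦ (trivializationAt E' (TangentSpace 𝓘(ℝ, E')) (F p) ⟨F x, W (F x)⟩).2) =
    coordAt E' (F p) W ∘ F := rfl
  rw [covAlong, h4, h3, ← key]
  ext u
  simp

/-- The normal connection: `D_u ξ` is the normal component of `∇̃_u ξ`. -/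
def normalDeriv (F : M → N) (ξ : Π x : M, TangentSpace 𝓘(ℝ, E') (F x)) (p : M) :
    TangentSpace 𝓘(ℝ, E) p →L[ℝ] TangentSpace 𝓘(ℝ, E') (F p) :=
  normalPart E E' F p ∘L covAlong E E' F ξ p

/-- The shape operator `A_ξ`: `-A_ξ u` is the tangential component of `∇̃_u ξ`. -/
def shapeOperator (F : M → N) (ξ : Π x : M, TangentSpace 𝓘(ℝ, E') (F x)) (p : M) :
    TangentSpace 𝓘(ℝ, E) p →L[ℝ] TangentSpace 𝓘(ℝ, E) p :=
  -(tangentPart E E' F p ∘L covAlong E E' F ξ p)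

/-- `M` has commutative second fundamental forms: `[A_ξ, A_η] = 0` for all normal vector fields. -/
def HasCommutativeSecondFundamentalForms (F : M → N) : Prop :=
  ∀ ξ η : Π x : M, TangentSpace 𝓘(ℝ, E') (F x), IsNormalField E E' F ξ → IsNormalField E E' F η →
    ∀ p : M, shapeOperator E E' F ξ p ∘L shapeOperator E E' F η p
      = shapeOperator E E' F η p ∘L shapeOperator E E' F ξ p

/-- The `f`-structure in the normal bundle: `f ξ` is the normal component of `J ξ`. -/
def fStructure (F : M → N)
    (J : Π y : N, TangentSpace 𝓘(ℝ, E') y →L[ℝ] TangentSpace 𝓘(ℝ, E') y) (p : M) :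
    TangentSpace 𝓘(ℝ, E') (F p) →L[ℝ] TangentSpace 𝓘(ℝ, E') (F p) :=
  normalPart E E' F p ∘L J (F p)

/-- The `f`-structure in the normal bundle is parallel: `D_u (f ξ) = f (D_u ξ)` for all normal
vector fields `ξ`. -/
def HasParallelFStructure (F : M → N)
    (J : Π y : N, TangentSpace 𝓘(ℝ, E') y →L[ℝ] TangentSpace 𝓘(ℝ, E') y) : Prop :=
  ∀ ξ : Π x : M, TangentSpace 𝓘(ℝ, E') (F x), IsNormalField E E' F ξ →
    ∀ (p : M) (u : TangentSpace 𝓘(ℝ, E) p),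
      normalDeriv E E' F (fun x ↦ fStructure E E' F J x (ξ x)) p u
        = fStructure E E' F J p (normalDeriv E E' F ξ p u)

variable [IsManifold 𝓘(ℝ, E) ∞ M]
  [IsContMDiffRiemannianBundle 𝓘(ℝ, E) ∞ E (fun x : M ↦ TangentSpace 𝓘(ℝ, E) x)]

/-- The second fundamental form on vector fields, by the Gauss formula
`∇̃_X Y = ∇_X Y + σ(X, Y)`, where `∇` is the Levi-Civita connection of `M`. -/
def secondFundamentalForm (F : M → N) (X Y : Π x : M, TangentSpace 𝓘(ℝ, E) x) (p : M) :
    TangentSpace 𝓘(ℝ, E') (F p) :=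
  covAlong E E' F (fun x ↦ mfderiv 𝓘(ℝ, E) 𝓘(ℝ, E') F x (Y x)) p (X p)
    - mfderiv 𝓘(ℝ, E) 𝓘(ℝ, E') F p (leviCivita Y p (X p))

/-- The second fundamental form on tangent vectors at `p`, evaluated on extensions of these
vectors that are smooth near `p`. -/
def secondFundamentalFormAt (F : M → N) (p : M) (u v : TangentSpace 𝓘(ℝ, E) p) :
    TangentSpace 𝓘(ℝ, E') (F p) :=
  secondFundamentalForm E E' F (extend E u) (extend E v) p

/-- `M` is totally geodesic: `σ = 0`. -/
def IsTotallyGeodesic (F : M → N) : Prop :=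
  ∀ (p : M) (u v : TangentSpace 𝓘(ℝ, E) p), secondFundamentalFormAt E E' F p u v = 0

/-- The mean curvature vector `H = (1 / n) tr σ`, with `n = dim M`. -/
def meanCurvature (F : M → N) (p : M) : TangentSpace 𝓘(ℝ, E') (F p) :=
  (Module.finrank ℝ E : ℝ)⁻¹ • ∑ i,
    secondFundamentalFormAt E E' F p (stdOrthonormalBasis ℝ (TangentSpace 𝓘(ℝ, E) p) i)
      (stdOrthonormalBasis ℝ (TangentSpace 𝓘(ℝ, E) p) i)

/-- The mean curvature vector is parallel in the normal bundle: `D H = 0`. -/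
def HasParallelMeanCurvature (F : M → N) : Prop :=
  ∀ (p : M) (u : TangentSpace 𝓘(ℝ, E) p), normalDeriv E E' F (meanCurvature E E' F) p u = 0

end Submanifold

end

end TotReal

/-!
The surface enters through the trilinear form `⟨σ(u, v), J w⟩`, which is totally symmetric because
`M` is totally real and `J` is parallel; equivalently, `S_u v = -(J σ(u, v))ᵀ` is symmetric in `u`
and `v` and every `S_u` is self-adjoint. Since `f (J Y) = 0` for tangent `Y`, parallelism of `f`
forces `f ∘ σ = 0`, so that `σ(u, v) = J (S_u v)` and the tangent field `h = -J H` is parallel along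
with `H`; its norm is then constant on the connected manifold `M`.

If `h` vanishes nowhere, the curvature operators of `M` kill `h` and are skew, so they vanish in
dimension two. If `h = 0`, every `S_u` is trace-free. Commutativity of the second fundamental forms
says that the operators `S_u` commute, whence `S_w ∘ S_w = S_{S_w w}`; so `tr (S_w ∘ S_w) = 0`, the
self-adjoint operator `S_w` vanishes, and with it `σ`.
-/

namespace TotReal

noncomputable section

/-! ### Calculus on manifolds -/

section Calculus

variable {E : Type*} [NormedAddCommGroup E] [NormedSpace ℝ E]
  {M : Type*} [TopologicalSpace M] [ChartedSpace E M]
  {G : Type*} [NormedAddCommGroup G] [NormedSpace ℝ G]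

theorem mvfderiv_congr_of_eventuallyEq {f g : M → G} {p : M} (h : f =ᶠ[nhds p] g) :
    mvfderiv 𝓘(ℝ, E) f p = mvfderiv 𝓘(ℝ, E) g p :=
  h.mfderiv_eq

theorem mvfderiv_clm_comp_apply {G' : Type*} [NormedAddCommGroup G'] [NormedSpace ℝ G']
    (L : G →L[ℝ] G') {f : M → G} {p : M} (hf : MDifferentiableAt 𝓘(ℝ, E) 𝓘(ℝ, G) f p)
    (v : TangentSpace 𝓘(ℝ, E) p) :
    mvfderiv 𝓘(ℝ, E) (fun x ↦ L (f x)) p v = L (mvfderiv 𝓘(ℝ, E) f p v) := by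
  have h := mfderiv_comp_apply p L.differentiableAt.mdifferentiableAt hf v
  rw [ContinuousLinearMap.mfderiv_eq] at h
  exact h

variable [IsManifold 𝓘(ℝ, E) ∞ M]

theorem contMDiffAt_mfderiv_apply {E' : Type*} [NormedAddCommGroup E'] [NormedSpace ℝ E']
    {N : Type*} [TopologicalSpace N] [ChartedSpace E' N] [IsManifold 𝓘(ℝ, E') ∞ N]
    {F : M → N} {X : Π x : M, TangentSpace 𝓘(ℝ, E) x} {p : M}
    (hF : ContMDiffAt 𝓘(ℝ, E) 𝓘(ℝ, E') ∞ F p) (hX : CMDiffAt ∞ (T% X) p) :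
    ContMDiffAt 𝓘(ℝ, E) (𝓘(ℝ, E').prod 𝓘(ℝ, E')) ∞
      (fun x ↦ (⟨F x, mfderiv 𝓘(ℝ, E) 𝓘(ℝ, E') F x (X x)⟩ : TangentBundle 𝓘(ℝ, E') N)) p :=
  ContMDiffAt.clm_apply_of_inCoordinates (b₁ := fun x : M ↦ x)
    (hF.mfderiv_const (m := ∞) (by simp)) hX hF

theorem contMDiffAt_mvfderiv_apply {f : M → G} {X : Π x : M, TangentSpace 𝓘(ℝ, E) x} {p : M}
    (hf : ContMDiffAt 𝓘(ℝ, E) 𝓘(ℝ, G) ∞ f p) (hX : CMDiffAt ∞ (T% X) p) :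
    ContMDiffAt 𝓘(ℝ, E) 𝓘(ℝ, G) ∞ (fun x ↦ mvfderiv 𝓘(ℝ, E) f x (X x)) p :=
  (contMDiff_snd_tangentBundle_modelSpace G 𝓘(ℝ, G)).contMDiffAt.comp p
    (contMDiffAt_mfderiv_apply hf hX)

theorem eventually_mdifferentiableAt {H : Type*} [TopologicalSpace H]
    {I : ModelWithCorners ℝ E H} {M : Type*} [TopologicalSpace M] [ChartedSpace H M]
    [IsManifold I 1 M] {H' : Type*} [TopologicalSpace H'] {I' : ModelWithCorners ℝ G H'}
    {N : Type*} [TopologicalSpace N] [ChartedSpace H' N] [IsManifold I' 1 N]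
    {f : M → N} {p : M} (hf : ContMDiffAt I I' ∞ f p) :
    ∀ᶠ x in nhds p, MDifferentiableAt I I' f x := by
  have hf₁ : ContMDiffAt I I' 1 f p := hf.of_le (by simp)
  filter_upwards [(contMDiffAt_iff_contMDiffAt_nhds (by simp)).1 hf₁] with x hx
  exact hx.mdifferentiableAt one_ne_zero

theorem contMDiffAt_mlieBracket [CompleteSpace E] {X Y : Π x : M, TangentSpace 𝓘(ℝ, E) x} {p : M}
    (hX : CMDiffAt ∞ (T% X) p) (hY : CMDiffAt ∞ (T% Y) p) :
    CMDiffAt ∞ (T% (mlieBracket 𝓘(ℝ, E) X Y)) p := by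
  have : IsManifold 𝓘(ℝ, E) (minSmoothness ℝ 2) M := by
    rw [minSmoothness_of_isRCLikeNormedField]
    infer_instance
  have : IsManifold 𝓘(ℝ, E) (∞ + 1) M := inferInstanceAs (IsManifold 𝓘(ℝ, E) ∞ M)
  exact ContMDiffAt.mlieBracket_vectorField (n := ⊤) (m := ⊤) hX hY (by simp)

section Bracket

variable [CompleteSpace E] {X Y : Π x : M, TangentSpace 𝓘(ℝ, E) x} {p : M}

theorem mlieBracket_mlieBracket_smul {f : M → ℝ} {W : Π x : M, TangentSpace 𝓘(ℝ, E) x}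
    (hf : ContMDiffAt 𝓘(ℝ, E) 𝓘(ℝ, ℝ) ∞ f p) (hY : CMDiffAt ∞ (T% Y) p)
    (hW : CMDiffAt ∞ (T% W) p) :
    mlieBracket 𝓘(ℝ, E) X (mlieBracket 𝓘(ℝ, E) Y (f • W)) p =
      mvfderiv 𝓘(ℝ, E) (fun x ↦ mvfderiv 𝓘(ℝ, E) f x (Y x)) p (X p) • W p
      + mvfderiv 𝓘(ℝ, E) f p (Y p) • mlieBracket 𝓘(ℝ, E) X W p
      + (mvfderiv 𝓘(ℝ, E) f p (X p) • mlieBracket 𝓘(ℝ, E) Y W p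
      + f p • mlieBracket 𝓘(ℝ, E) X (mlieBracket 𝓘(ℝ, E) Y W) p) := by
  have hYf := contMDiffAt_mvfderiv_apply hf hY
  have hYW := contMDiffAt_mlieBracket hY hW
  have hYfW : mlieBracket 𝓘(ℝ, E) Y (f • W) =ᶠ[nhds p]
      (fun x ↦ mvfderiv 𝓘(ℝ, E) f x (Y x)) • W + f • mlieBracket 𝓘(ℝ, E) Y W := by
    filter_upwards [eventually_mdifferentiableAt hf, eventually_mdifferentiableAt hW]
      with x hfx hWx
    exact mlieBracket_smul_right hfx hWx
  rw [Filter.EventuallyEq.rfl.mlieBracket_vectorField_eq hYfW,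
    mlieBracket_add_right ((hYf.smul_section hW).mdifferentiableAt (by simp))
      ((hf.smul_section hYW).mdifferentiableAt (by simp)),
    mlieBracket_smul_right (hYf.mdifferentiableAt (by simp)) (hW.mdifferentiableAt (by simp)),
    mlieBracket_smul_right (hf.mdifferentiableAt (by simp)) (hYW.mdifferentiableAt (by simp))]

theorem mvfderiv_mlieBracket_smul {f : M → ℝ} {W : Π x : M, TangentSpace 𝓘(ℝ, E) x}
    (hf : ContMDiffAt 𝓘(ℝ, E) 𝓘(ℝ, ℝ) ∞ f p) (hX : CMDiffAt ∞ (T% X) p)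
    (hY : CMDiffAt ∞ (T% Y) p) (hW : CMDiffAt ∞ (T% W) p) :
    mvfderiv 𝓘(ℝ, E) f p (mlieBracket 𝓘(ℝ, E) X Y p) • W p =
      (mvfderiv 𝓘(ℝ, E) (fun x ↦ mvfderiv 𝓘(ℝ, E) f x (Y x)) p (X p)
        - mvfderiv 𝓘(ℝ, E) (fun x ↦ mvfderiv 𝓘(ℝ, E) f x (X x)) p (Y p)) • W p := by
  have jacobi : ∀ V : Π x : M, TangentSpace 𝓘(ℝ, E) x, CMDiffAt ∞ (T% V) p →
      mlieBracket 𝓘(ℝ, E) X (mlieBracket 𝓘(ℝ, E) Y V) p =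
        mlieBracket 𝓘(ℝ, E) (mlieBracket 𝓘(ℝ, E) X Y) V p
        + mlieBracket 𝓘(ℝ, E) Y (mlieBracket 𝓘(ℝ, E) X V) p := fun V hV ↦ by
    have : IsManifold 𝓘(ℝ, E) (minSmoothness ℝ 3) M := by
      rw [minSmoothness_of_isRCLikeNormedField]
      infer_instance
    have hsmooth : minSmoothness ℝ 2 ≤ ∞ := by
      rw [minSmoothness_of_isRCLikeNormedField]
      exact ENat.LEInfty.out
    exact leibniz_identity_mlieBracket_apply (hX.of_le hsmooth) (hY.of_le hsmooth)
      (hV.of_le hsmooth)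
  -- Compare the Jacobi identities for `X`, `Y`, `f • W` and for `X`, `Y`, `W`.
  have hfW := jacobi (f • W) (hf.smul_section hW)
  rw [mlieBracket_mlieBracket_smul hf hY hW, mlieBracket_mlieBracket_smul hf hX hW,
    mlieBracket_smul_right (hf.mdifferentiableAt (by simp)) (hW.mdifferentiableAt (by simp)),
    jacobi W hW] at hfW
  linear_combination (norm := module) -hfW

theorem mvfderiv_mlieBracket_real {f : M → ℝ} (hf : ContMDiffAt 𝓘(ℝ, E) 𝓘(ℝ, ℝ) ∞ f p)
    (hX : CMDiffAt ∞ (T% X) p) (hY : CMDiffAt ∞ (T% Y) p) :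
    mvfderiv 𝓘(ℝ, E) f p (mlieBracket 𝓘(ℝ, E) X Y p) =
      mvfderiv 𝓘(ℝ, E) (fun x ↦ mvfderiv 𝓘(ℝ, E) f x (Y x)) p (X p)
        - mvfderiv 𝓘(ℝ, E) (fun x ↦ mvfderiv 𝓘(ℝ, E) f x (X x)) p (Y p) := by
  rcases subsingleton_or_nontrivial (TangentSpace 𝓘(ℝ, E) p) with _ | _
  · simp [Subsingleton.elim (X p) 0, Subsingleton.elim (Y p) 0,
      Subsingleton.elim (mlieBracket 𝓘(ℝ, E) X Y p) 0]
  · obtain ⟨w, hw⟩ := exists_ne (0 : TangentSpace 𝓘(ℝ, E) p)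
    have h := mvfderiv_mlieBracket_smul hf hX hY (contMDiffAt_extend (k := ∞) 𝓘(ℝ, E) E w)
    rw [extend_apply_self] at h
    exact smul_left_injective ℝ hw h

theorem mvfderiv_mlieBracket {f : M → G} (hf : ContMDiffAt 𝓘(ℝ, E) 𝓘(ℝ, G) ∞ f p)
    (hX : CMDiffAt ∞ (T% X) p) (hY : CMDiffAt ∞ (T% Y) p) :
    mvfderiv 𝓘(ℝ, E) f p (mlieBracket 𝓘(ℝ, E) X Y p) =
      mvfderiv 𝓘(ℝ, E) (fun x ↦ mvfderiv 𝓘(ℝ, E) f x (Y x)) p (X p)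
        - mvfderiv 𝓘(ℝ, E) (fun x ↦ mvfderiv 𝓘(ℝ, E) f x (X x)) p (Y p) := by
  have second : ∀ (L : G →L[ℝ] ℝ) {V : Π x : M, TangentSpace 𝓘(ℝ, E) x}, CMDiffAt ∞ (T% V) p →
      ∀ u, mvfderiv 𝓘(ℝ, E) (fun x ↦ mvfderiv 𝓘(ℝ, E) (fun y ↦ L (f y)) x (V x)) p u =
        L (mvfderiv 𝓘(ℝ, E) (fun x ↦ mvfderiv 𝓘(ℝ, E) f x (V x)) p u) := fun L V hV u ↦ by
    rw [← mvfderiv_clm_comp_apply L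
      ((contMDiffAt_mvfderiv_apply hf hV).mdifferentiableAt (by simp))]
    refine DFunLike.congr_fun (mvfderiv_congr_of_eventuallyEq ?_) u
    filter_upwards [eventually_mdifferentiableAt hf] with x hfx
    exact mvfderiv_clm_comp_apply L hfx _
  refine SeparatingDual.eq_iff_forall_dual_eq (R := ℝ) |>.2 fun L ↦ ?_
  have hLf : ContMDiffAt 𝓘(ℝ, E) 𝓘(ℝ, ℝ) ∞ (fun x ↦ L (f x)) p :=
    L.contMDiff.contMDiffAt.comp p hf
  rw [map_sub, ← second L hX, ← second L hY,
    ← mvfderiv_clm_comp_apply L (hf.mdifferentiableAt (by simp))]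
  exact mvfderiv_mlieBracket_real hLf hX hY

end Bracket

theorem isLocallyConstant_of_mvfderiv_eq_zero {f : M → G}
    (hf : ∀ x, MDifferentiableAt 𝓘(ℝ, E) 𝓘(ℝ, G) f x) (h : ∀ x, mvfderiv 𝓘(ℝ, E) f x = 0) :
    IsLocallyConstant f := by
  refine (IsLocallyConstant.iff_eventually_eq f).2 fun p ↦ ?_
  set φ := extChartAt 𝓘(ℝ, E) p
  have hderiv : ∀ z ∈ φ.target, HasFDerivAt (f ∘ φ.symm) (0 : E →L[ℝ] G) z := fun z hz ↦ by
    have hφ : MDifferentiableAt 𝓘(ℝ, E) 𝓘(ℝ, E) φ.symm z :=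
      ((contMDiffOn_extChartAt_symm (n := ∞) p).contMDiffAt
        ((isOpen_extChartAt_target p).mem_nhds hz)).mdifferentiableAt (by simp)
    have hcomp := (hf (φ.symm z)).hasMFDerivAt.comp z hφ.hasMFDerivAt
    have hzero : mfderiv 𝓘(ℝ, E) 𝓘(ℝ, G) f (φ.symm z) = 0 := h (φ.symm z)
    rw [hzero, ContinuousLinearMap.zero_comp] at hcomp
    exact hcomp.hasFDerivAt
  have hopen : IsOpen (φ.target ∩ (f ∘ φ.symm) ⁻¹' {f p}) :=
    (isOpen_extChartAt_target p).isOpen_inter_preimage_of_fderiv_eq_zero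
      (fun z hz ↦ (hderiv z hz).differentiableAt.differentiableWithinAt)
      (fun z hz ↦ (hderiv z hz).fderiv) {f p}
  have hmem : φ p ∈ φ.target ∩ (f ∘ φ.symm) ⁻¹' {f p} :=
    ⟨mem_extChartAt_target p, congrArg f (extChartAt_to_inv p)⟩
  filter_upwards [extChartAt_source_mem_nhds (I := 𝓘(ℝ, E)) p,
    (continuousAt_extChartAt p).preimage_mem_nhds (hopen.mem_nhds hmem)] with q hq hq'
  exact (congrArg f (φ.left_inv hq)).symm.trans hq'.2

theorem eq_of_mvfderiv_eq_zero [PreconnectedSpace M] {f : M → G}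
    (hf : ∀ x, MDifferentiableAt 𝓘(ℝ, E) 𝓘(ℝ, G) f x) (h : ∀ x, mvfderiv 𝓘(ℝ, E) f x = 0)
    (x y : M) : f x = f y :=
  (isLocallyConstant_of_mvfderiv_eq_zero hf h).apply_eq_of_isPreconnected isPreconnected_univ
    (Set.mem_univ x) (Set.mem_univ y)

end Calculus

section Matrix

open Matrix

variable {E : Type*} [NormedAddCommGroup E] [NormedSpace ℝ E]
  {M : Type*} [TopologicalSpace M] [ChartedSpace E M] {ι : Type*} [Fintype ι] [DecidableEq ι]

theorem contMDiffAt_det {A : M → Matrix ι ι ℝ} {p : M}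
    (hA : ∀ i j, ContMDiffAt 𝓘(ℝ, E) 𝓘(ℝ, ℝ) ∞ (fun x ↦ A x i j) p) :
    ContMDiffAt 𝓘(ℝ, E) 𝓘(ℝ, ℝ) ∞ (fun x ↦ (A x).det) p := by
  simp only [Matrix.det_apply']
  exact ContMDiffAt.sum fun s _ ↦ contMDiffAt_const.mul (ContMDiffAt.prod fun i _ ↦ hA (s i) i)

theorem contMDiffAt_of_mulVec {A : M → Matrix ι ι ℝ} {c : M → ι → ℝ} {p : M}
    (hA : ∀ i j, ContMDiffAt 𝓘(ℝ, E) 𝓘(ℝ, ℝ) ∞ (fun x ↦ A x i j) p) (hdet : (A p).det ≠ 0)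
    (hAc : ∀ i, ContMDiffAt 𝓘(ℝ, E) 𝓘(ℝ, ℝ) ∞ (fun x ↦ (A x *ᵥ c x) i) p) (i : ι) :
    ContMDiffAt 𝓘(ℝ, E) 𝓘(ℝ, ℝ) ∞ (fun x ↦ c x i) p := by
  have hdet' := contMDiffAt_det hA
  have hcramer : ContMDiffAt 𝓘(ℝ, E) 𝓘(ℝ, ℝ) ∞ (fun x ↦ cramer (A x) (A x *ᵥ c x) i) p := by
    simp only [cramer_apply]
    refine contMDiffAt_det fun j k ↦ ?_
    rcases eq_or_ne k i with rfl | hk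
    · simpa only [updateCol_self] using hAc j
    · simpa only [updateCol_ne hk] using hA j k
  refine (hcramer.div₀ hdet' hdet).congr_of_eventuallyEq ?_
  filter_upwards [hdet'.continuousAt.eventually_ne hdet] with x hx
  simp [eq_div_iff hx, cramer_eq_adjugate_mulVec, adjugate_mul, smul_mulVec, mul_comm]

end Matrix

theorem contMDiffAt_trace {E : Type*} [NormedAddCommGroup E] [NormedSpace ℝ E]
    [FiniteDimensional ℝ E] {M : Type*} [TopologicalSpace M] [ChartedSpace E M]
    [IsManifold 𝓘(ℝ, E) ∞ M] {p : M}
    {T : Π x : M, TangentSpace 𝓘(ℝ, E) x →ₗ[ℝ] TangentSpace 𝓘(ℝ, E) x}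
    (hT : ∀ W : Π x : M, TangentSpace 𝓘(ℝ, E) x, CMDiffAt ∞ (T% W) p →
      CMDiffAt ∞ (T% (fun x ↦ T x (W x))) p) :
    ContMDiffAt 𝓘(ℝ, E) 𝓘(ℝ, ℝ) ∞ (fun x ↦ LinearMap.trace ℝ (TangentSpace 𝓘(ℝ, E) x) (T x)) p := by
  set e := trivializationAt E (TangentSpace 𝓘(ℝ, E)) p
  have hp : p ∈ e.baseSet := FiberBundle.mem_baseSet_trivializationAt' p
  let b := Module.finBasis ℝ E
  let W := e.localFrame b
  have hsum : ContMDiffAt 𝓘(ℝ, E) 𝓘(ℝ, ℝ) ∞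
      (fun x ↦ ∑ i, e.localFrameCoeff 𝓘(ℝ, E) b i x (T x (W i x))) p :=
    ContMDiffAt.sum fun i _ ↦ contMDiffAt_localFrameCoeff b hp
      (hT _ (contMDiffAt_localFrame_of_mem (I := 𝓘(ℝ, E)) ∞ e b i hp)) i
  refine hsum.congr_of_eventuallyEq ?_
  filter_upwards [e.open_baseSet.mem_nhds hp] with x hx
  rw [LinearMap.trace_eq_matrix_trace ℝ (e.basisAt b hx), Matrix.trace]
  refine Finset.sum_congr rfl fun i _ ↦ ?_
  rw [Matrix.diag_apply, LinearMap.toMatrix_apply, ← e.localFrame_apply_of_mem_baseSet b hx]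
  exact (e.localFrameCoeff_apply_of_mem_baseSet (I := 𝓘(ℝ, E)) b hx (fun x ↦ T x (W i x)) i).symm

theorem exists_contMDiff_apply_eq {E : Type*} [NormedAddCommGroup E] [NormedSpace ℝ E]
    [FiniteDimensional ℝ E] {M : Type*} [TopologicalSpace M] [T2Space M] [ChartedSpace E M]
    [IsManifold 𝓘(ℝ, E) ∞ M] {p : M} (v : TangentSpace 𝓘(ℝ, E) p) :
    ∃ X : Π x : M, TangentSpace 𝓘(ℝ, E) x,
      ContMDiff 𝓘(ℝ, E) (𝓘(ℝ, E).prod 𝓘(ℝ, E)) ∞ (T% X) ∧ X p = v := by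
  obtain ⟨s, hs, hsv⟩ := exists_contMDiffOn_extend (k := ∞) 𝓘(ℝ, E) E v
  obtain ⟨f, -, hf⟩ := (SmoothBumpFunction.nhds_basis_tsupport (I := 𝓘(ℝ, E)) p).mem_iff.1
    (interior_mem_nhds.2 hs)
  exact ⟨(f : M → ℝ) • extend E v, ContMDiffOn.smul_section_of_tsupport f.contMDiff.contMDiffOn
    isOpen_interior hf (hsv.mono interior_subset), by simp⟩

/-! ### Levi-Civita connection, curvature and parallel fields -/

section LeviCivita

variable {E : Type*} [NormedAddCommGroup E] [NormedSpace ℝ E]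
  {M : Type*} [TopologicalSpace M] [ChartedSpace E M] [IsManifold 𝓘(ℝ, E) ∞ M]
  [RiemannianBundle (fun x : M ↦ TangentSpace 𝓘(ℝ, E) x)]
  [IsContMDiffRiemannianBundle 𝓘(ℝ, E) ∞ E (fun x : M ↦ TangentSpace 𝓘(ℝ, E) x)]

theorem contMDiffAt_inner {Y Z : Π x : M, TangentSpace 𝓘(ℝ, E) x} {p : M}
    (hY : CMDiffAt ∞ (T% Y) p) (hZ : CMDiffAt ∞ (T% Z) p) :
    ContMDiffAt 𝓘(ℝ, E) 𝓘(ℝ, ℝ) ∞ (fun x ↦ (inner ℝ (Y x) (Z x) : ℝ)) p :=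
  ContMDiffAt.inner_bundle (F := E) (E := fun x : M ↦ TangentSpace 𝓘(ℝ, E) x) hY hZ

variable [FiniteDimensional ℝ E]

theorem contMDiffAt_of_inner {V : Π x : M, TangentSpace 𝓘(ℝ, E) x} {p : M}
    (h : ∀ W : Π x : M, TangentSpace 𝓘(ℝ, E) x, CMDiffAt ∞ (T% W) p →
      ContMDiffAt 𝓘(ℝ, E) 𝓘(ℝ, ℝ) ∞ (fun x ↦ (inner ℝ (W x) (V x) : ℝ)) p) :
    CMDiffAt ∞ (T% V) p := by
  set e := trivializationAt E (TangentSpace 𝓘(ℝ, E)) p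
  have hp : p ∈ e.baseSet := FiberBundle.mem_baseSet_trivializationAt' p
  let b := Module.finBasis ℝ E
  let w := e.localFrame b
  have hw : ∀ i, CMDiffAt ∞ (T% (w i)) p := fun i ↦
    contMDiffAt_localFrame_of_mem (I := 𝓘(ℝ, E)) ∞ e b i hp
  let A : M → Matrix _ _ ℝ := fun x ↦ Matrix.gram ℝ fun i ↦ w i x
  have hdet : (A p).det ≠ 0 :=
    (Matrix.posDef_gram_of_linearIndependent
      ((e.isLocalFrameOn_localFrame_baseSet 𝓘(ℝ, E) ∞ b).linearIndependent hp)).det_pos.ne'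
  refine (contMDiffAt_iff_localFrameCoeff (I := 𝓘(ℝ, E)) b hp).2
    (contMDiffAt_of_mulVec (A := A) (c := fun x i ↦ e.localFrameCoeff 𝓘(ℝ, E) b i x (V x))
      (fun i j ↦ contMDiffAt_inner (hw i) (hw j)) hdet fun i ↦ ?_)
  refine (h _ (hw i)).congr_of_eventuallyEq ?_
  filter_upwards [e.open_baseSet.mem_nhds hp] with x hx
  conv_rhs => rw [e.eq_sum_localFrameCoeff_smul (I := 𝓘(ℝ, E)) (b := b) (s := V) hx]
  simp only [A, Matrix.mulVec, dotProduct, Matrix.gram_apply, inner_sum, inner_smul_right, mul_comm]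
  rfl

theorem contMDiffAt_leviCivita {X Y : Π x : M, TangentSpace 𝓘(ℝ, E) x} {p : M}
    (hX : CMDiffAt ∞ (T% X) p) (hY : CMDiffAt ∞ (T% Y) p) :
    CMDiffAt ∞ (T% (fun x ↦ leviCivita Y x (X x))) p := by
  refine contMDiffAt_of_inner fun Z hZ ↦ ?_
  have hkoszul : ContMDiffAt 𝓘(ℝ, E) 𝓘(ℝ, ℝ) ∞ (koszul X Y Z) p :=
    (((((contMDiffAt_mvfderiv_apply (contMDiffAt_inner hY hZ) hX).add
      (contMDiffAt_mvfderiv_apply (contMDiffAt_inner hX hZ) hY)).sub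
      (contMDiffAt_mvfderiv_apply (contMDiffAt_inner hX hY) hZ)).add
      (contMDiffAt_inner (contMDiffAt_mlieBracket hX hY) hZ)).sub
      (contMDiffAt_inner (contMDiffAt_mlieBracket hX hZ) hY)).sub
      (contMDiffAt_inner (contMDiffAt_mlieBracket hY hZ) hX)
  refine (contMDiffAt_const (c := (1 / 2 : ℝ)).mul hkoszul).congr_of_eventuallyEq ?_
  filter_upwards [eventually_mdifferentiableAt hX, eventually_mdifferentiableAt hY,
    eventually_mdifferentiableAt hZ] with x hx hy hz
  rw [Pi.mul_apply, ← inner_leviCivita hx hy hz, real_inner_comm]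
  ring

section Curvature

variable {X Y Z W : Π x : M, TangentSpace 𝓘(ℝ, E) x} {p : M}

/-- The curvature tensor `R(X, Y)Z = ∇_X ∇_Y Z - ∇_Y ∇_X Z - ∇_[X, Y] Z`, evaluated on vector
fields. -/
def curvature (X Y Z : Π x : M, TangentSpace 𝓘(ℝ, E) x) (p : M) : TangentSpace 𝓘(ℝ, E) p :=
  leviCivita (fun x ↦ leviCivita Z x (Y x)) p (X p)
    - leviCivita (fun x ↦ leviCivita Z x (X x)) p (Y p)
    - leviCivita Z p (mlieBracket 𝓘(ℝ, E) X Y p)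

theorem mvfderiv_mvfderiv_inner (hX : CMDiffAt ∞ (T% X) p) (hY : CMDiffAt ∞ (T% Y) p)
    (hZ : CMDiffAt ∞ (T% Z) p) (hW : CMDiffAt ∞ (T% W) p) :
    mvfderiv 𝓘(ℝ, E) (fun x ↦ mvfderiv 𝓘(ℝ, E) (fun y ↦ (inner ℝ (Z y) (W y) : ℝ)) x (Y x)) p (X p)
      = inner ℝ (leviCivita (fun x ↦ leviCivita Z x (Y x)) p (X p)) (W p)
        + inner ℝ (leviCivita Z p (Y p)) (leviCivita W p (X p))
        + (inner ℝ (leviCivita Z p (X p)) (leviCivita W p (Y p))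
        + inner ℝ (Z p) (leviCivita (fun x ↦ leviCivita W x (Y x)) p (X p))) := by
  have mdiff : ∀ {V : Π x : M, TangentSpace 𝓘(ℝ, E) x}, CMDiffAt ∞ (T% V) p → MDiffAt (T% V) p :=
    fun hV ↦ hV.mdifferentiableAt (by simp)
  have hYZ := contMDiffAt_leviCivita hY hZ
  have hYW := contMDiffAt_leviCivita hY hW
  have hfirst : (fun x ↦ mvfderiv 𝓘(ℝ, E) (fun y ↦ (inner ℝ (Z y) (W y) : ℝ)) x (Y x)) =ᶠ[nhds p]
      fun x ↦ inner ℝ (leviCivita Z x (Y x)) (W x) + inner ℝ (Z x) (leviCivita W x (Y x)) := by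
    filter_upwards [eventually_mdifferentiableAt hY, eventually_mdifferentiableAt hZ,
      eventually_mdifferentiableAt hW] with x hy hz hw
    exact leviCivita_metric hy hz hw
  rw [mvfderiv_congr_of_eventuallyEq hfirst,
    mvfderiv_fun_add (mdifferentiableAt_inner (mdiff hYZ) (mdiff hW))
      (mdifferentiableAt_inner (mdiff hZ) (mdiff hYW)), add_apply,
    leviCivita_metric (mdiff hX) (mdiff hYZ) (mdiff hW),
    leviCivita_metric (mdiff hX) (mdiff hZ) (mdiff hYW)]

theorem inner_curvature_left (hX : CMDiffAt ∞ (T% X) p) (hY : CMDiffAt ∞ (T% Y) p)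
    (hZ : CMDiffAt ∞ (T% Z) p) (hW : CMDiffAt ∞ (T% W) p) :
    (inner ℝ (curvature X Y Z p) (W p) : ℝ) = -inner ℝ (Z p) (curvature X Y W p) := by
  have h := mvfderiv_mlieBracket (contMDiffAt_inner hZ hW) hX hY
  rw [mvfderiv_mvfderiv_inner hX hY hZ hW, mvfderiv_mvfderiv_inner hY hX hZ hW,
    leviCivita_metric ((contMDiffAt_mlieBracket hX hY).mdifferentiableAt (by simp))
      (hZ.mdifferentiableAt (by simp)) (hW.mdifferentiableAt (by simp))] at h
  simp only [curvature, inner_sub_left, inner_sub_right]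
  linarith

end Curvature

/-- Parallel vector fields: smooth fields `h` with `∇h = 0`. -/
structure IsParallel (h : Π x : M, TangentSpace 𝓘(ℝ, E) x) : Prop where
  contMDiffAt (p : M) : CMDiffAt ∞ (T% h) p
  leviCivita_eq_zero (p : M) : leviCivita h p = 0

theorem IsParallel.inner_self_eq [PreconnectedSpace M] {h : Π x : M, TangentSpace 𝓘(ℝ, E) x}
    (hpar : IsParallel h) (p q : M) : (inner ℝ (h p) (h p) : ℝ) = inner ℝ (h q) (h q) := by
  have hdiff : ∀ x, MDiffAt (T% h) x := fun x ↦ (hpar.contMDiffAt x).mdifferentiableAt (by simp)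
  refine eq_of_mvfderiv_eq_zero (E := E) (f := fun x ↦ (inner ℝ (h x) (h x) : ℝ))
    (fun x ↦ mdifferentiableAt_inner (hdiff x) (hdiff x)) (fun x ↦ ?_) p q
  ext u
  have hmetric := leviCivita_metric (mdifferentiableAt_extend 𝓘(ℝ, E) E u) (hdiff x) (hdiff x)
  simpa [hpar.leviCivita_eq_zero] using hmetric

theorem IsParallel.eq_zero_of_apply_eq_zero [PreconnectedSpace M]
    {h : Π x : M, TangentSpace 𝓘(ℝ, E) x} (hpar : IsParallel h) {p : M} (hp : h p = 0) (q : M) :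
    h q = 0 := by
  rw [← inner_self_eq_zero (𝕜 := ℝ), hpar.inner_self_eq q p, hp, inner_zero_left]

theorem IsParallel.curvature_eq_zero {h : Π x : M, TangentSpace 𝓘(ℝ, E) x} (hpar : IsParallel h)
    (X Y : Π x : M, TangentSpace 𝓘(ℝ, E) x) (p : M) : curvature X Y h p = 0 := by
  have hzero : ∀ U : Π x : M, TangentSpace 𝓘(ℝ, E) x, (fun x ↦ leviCivita h x (U x)) = 0 :=
    fun U ↦ funext fun x ↦ by rw [hpar.leviCivita_eq_zero, zero_apply, Pi.zero_apply]
  rw [curvature, hzero, hzero, CovariantDerivative.zero, hpar.leviCivita_eq_zero]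
  simp

theorem exists_forall_eq_zero_of_inner_eq_zero {V : Type*} [NormedAddCommGroup V]
    [InnerProductSpace ℝ V] (hV : Module.finrank ℝ V = 2) {a : V} (ha : a ≠ 0) :
    ∃ w : V, ∀ v : V, inner ℝ v a = (0 : ℝ) → inner ℝ v w = (0 : ℝ) → v = 0 := by
  have : Fact (Module.finrank ℝ V = 1 + 1) := ⟨hV⟩
  obtain ⟨w, -, hspan⟩ := finrank_eq_one_iff'.1
    (Submodule.finrank_orthogonal_span_singleton (𝕜 := ℝ) ha)
  refine ⟨w, fun v hva hvw ↦ ?_⟩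
  obtain ⟨c, hc⟩ := hspan ⟨v, Submodule.mem_orthogonal_singleton_iff_inner_left.2 hva⟩
  rw [← inner_self_eq_zero (𝕜 := ℝ)]
  nth_rewrite 2 [← show c • (w : V) = v from congrArg Subtype.val hc]
  rw [inner_smul_right, hvw, mul_zero]

theorem IsParallel.isFlat (hdim : Module.finrank ℝ E = 2) {h : Π x : M, TangentSpace 𝓘(ℝ, E) x}
    (hpar : IsParallel h) (hne : ∀ p, h p ≠ 0) : IsFlat E M := by
  intro X Y Z hX hY hZ p
  obtain ⟨w, hw⟩ := exists_forall_eq_zero_of_inner_eq_zero (V := TangentSpace 𝓘(ℝ, E) p) hdim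
    (hne p)
  have hW := contMDiffAt_extend (k := ∞) 𝓘(ℝ, E) E w
  have orthogonal : ∀ {V : Π x : M, TangentSpace 𝓘(ℝ, E) x}, CMDiffAt ∞ (T% V) p →
      (inner ℝ (curvature X Y V p) (h p) : ℝ) = 0 := fun hV ↦ by
    rw [inner_curvature_left (hX p) (hY p) hV (hpar.contMDiffAt p), hpar.curvature_eq_zero,
      inner_zero_right, neg_zero]
  have hcurvW : curvature X Y (extend E w) p = 0 := by
    refine hw _ (orthogonal hW) ?_
    have hskew := inner_curvature_left (hX p) (hY p) hW hW
    rw [extend_apply_self] at hskew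
    linarith [real_inner_comm w (curvature X Y (extend E w) p)]
  refine hw _ (orthogonal (hZ p)) ?_
  have hskew := inner_curvature_left (hX p) (hY p) (hZ p) hW
  rwa [extend_apply_self, hcurvW, inner_zero_right, neg_zero] at hskew

end LeviCivita

/-! ### Vector fields along a map -/

section Along

theorem symmL_trivializationAt_snd {E' : Type*} [NormedAddCommGroup E'] [NormedSpace ℝ E']
    {N : Type*} [TopologicalSpace N] [ChartedSpace E' N] [IsManifold 𝓘(ℝ, E') ∞ N] {q : N}
    (v : TangentSpace 𝓘(ℝ, E') q) :
    (trivializationAt E' (TangentSpace 𝓘(ℝ, E')) q).symmL ℝ q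
      (trivializationAt E' (TangentSpace 𝓘(ℝ, E')) q ⟨q, v⟩).2 = v := by
  rw [Trivialization.symmL_apply _ (FiberBundle.mem_baseSet_trivializationAt' q)]
  exact extend_apply_self E' v

variable {E : Type*} [NormedAddCommGroup E] [NormedSpace ℝ E]
  {M : Type*} [TopologicalSpace M] [ChartedSpace E M]
  {E' : Type*} [NormedAddCommGroup E'] [NormedSpace ℝ E']
  {N : Type*} [TopologicalSpace N] [ChartedSpace E' N] [IsManifold 𝓘(ℝ, E') ∞ N]

variable (E) in
/-- Smoothness at `p` of the vector field `V` along `F`, as a map into the tangent bundle. -/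
abbrev SmoothAlongAt (F : M → N) (V : Π x : M, TangentSpace 𝓘(ℝ, E') (F x)) (p : M) : Prop :=
  ContMDiffAt 𝓘(ℝ, E) (𝓘(ℝ, E').prod 𝓘(ℝ, E')) ∞
    (fun x ↦ (⟨F x, V x⟩ : TangentBundle 𝓘(ℝ, E') N)) p

variable (E) in
/-- Differentiability at `p` of the vector field `V` along `F`, as a map into the tangent
bundle. -/
abbrev DiffAlongAt (F : M → N) (V : Π x : M, TangentSpace 𝓘(ℝ, E') (F x)) (p : M) : Prop :=
  MDifferentiableAt 𝓘(ℝ, E) (𝓘(ℝ, E').prod 𝓘(ℝ, E'))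
    (fun x ↦ (⟨F x, V x⟩ : TangentBundle 𝓘(ℝ, E') N)) p

/-- The coordinates of a vector field along `F` in the trivialization of the tangent bundle
around `q`; only meaningful at the points `x` with `F x` in its base set. -/
def coordAlong (F : M → N) (q : N) (V : Π x : M, TangentSpace 𝓘(ℝ, E') (F x)) (x : M) : E' :=
  (trivializationAt E' (TangentSpace 𝓘(ℝ, E')) q ⟨F x, V x⟩).2

variable {F : M → N} {p : M} {V V' : Π x : M, TangentSpace 𝓘(ℝ, E') (F x)}

theorem smoothAlongAt_iff : SmoothAlongAt E F V p ↔ ContMDiffAt 𝓘(ℝ, E) 𝓘(ℝ, E') ∞ F p ∧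
    ContMDiffAt 𝓘(ℝ, E) 𝓘(ℝ, E') ∞ (coordAlong F (F p) V) p :=
  Bundle.contMDiffAt_totalSpace

theorem diffAlongAt_iff : DiffAlongAt E F V p ↔ MDifferentiableAt 𝓘(ℝ, E) 𝓘(ℝ, E') F p ∧
    MDifferentiableAt 𝓘(ℝ, E) 𝓘(ℝ, E') (coordAlong F (F p) V) p :=
  mdifferentiableAt_totalSpace _ _

theorem SmoothAlongAt.diffAlongAt (hV : SmoothAlongAt E F V p) : DiffAlongAt E F V p :=
  hV.mdifferentiableAt (by simp)

theorem SmoothAlongAt.contMDiffAt_base (hV : SmoothAlongAt E F V p) :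
    ContMDiffAt 𝓘(ℝ, E) 𝓘(ℝ, E') ∞ F p :=
  (smoothAlongAt_iff.1 hV).1

theorem eventually_mem_baseSet (hF : ContinuousAt F p) :
    ∀ᶠ x in nhds p, F x ∈ (trivializationAt E' (TangentSpace 𝓘(ℝ, E')) (F p)).baseSet :=
  hF.eventually_mem ((trivializationAt E' (TangentSpace 𝓘(ℝ, E')) (F p)).open_baseSet.mem_nhds
    (FiberBundle.mem_baseSet_trivializationAt' (F := E') (E := TangentSpace 𝓘(ℝ, E')) (F p)))

theorem coordAlong_add (hF : ContinuousAt F p) (V V' : Π x : M, TangentSpace 𝓘(ℝ, E') (F x)) :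
    coordAlong F (F p) (fun x ↦ V x + V' x) =ᶠ[nhds p]
      coordAlong F (F p) V + coordAlong F (F p) V' := by
  filter_upwards [eventually_mem_baseSet (E' := E') hF] with x hx
  exact ((trivializationAt E' (TangentSpace 𝓘(ℝ, E')) (F p)).linear ℝ hx).map_add (V x) (V' x)

theorem coordAlong_smul (hF : ContinuousAt F p) (g : M → ℝ)
    (V : Π x : M, TangentSpace 𝓘(ℝ, E') (F x)) :
    coordAlong F (F p) (fun x ↦ g x • V x) =ᶠ[nhds p] g • coordAlong F (F p) V := by
  filter_upwards [eventually_mem_baseSet (E' := E') hF] with x hx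
  exact ((trivializationAt E' (TangentSpace 𝓘(ℝ, E')) (F p)).linear ℝ hx).map_smul (g x) (V x)

theorem smoothAlongAt_comp (hF : ContMDiffAt 𝓘(ℝ, E) 𝓘(ℝ, E') ∞ F p)
    {W : Π y : N, TangentSpace 𝓘(ℝ, E') y} (hW : CMDiffAt ∞ (T% W) (F p)) :
    SmoothAlongAt E F (fun x ↦ W (F x)) p :=
  ContMDiffAt.comp p hW hF

theorem diffAlongAt_mfderiv [IsManifold 𝓘(ℝ, E) ∞ M] (hF : ContMDiffAt 𝓘(ℝ, E) 𝓘(ℝ, E') ∞ F p)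
    {Y : Π x : M, TangentSpace 𝓘(ℝ, E) x} (hY : MDiffAt (T% Y) p) :
    DiffAlongAt E F (fun x ↦ mfderiv 𝓘(ℝ, E) 𝓘(ℝ, E') F x (Y x)) p :=
  MDifferentiableAt.clm_apply_of_inCoordinates (b₁ := fun x : M ↦ x)
    ((hF.mfderiv_const (m := ∞) (by simp)).mdifferentiableAt (by simp)) hY
    (hF.mdifferentiableAt (by simp))

theorem SmoothAlongAt.add (hV : SmoothAlongAt E F V p) (hV' : SmoothAlongAt E F V' p) :
    SmoothAlongAt E F (fun x ↦ V x + V' x) p := by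
  obtain ⟨hF, hcoord⟩ := smoothAlongAt_iff.1 hV
  exact smoothAlongAt_iff.2 ⟨hF, (hcoord.add (smoothAlongAt_iff.1 hV').2).congr_of_eventuallyEq
    (coordAlong_add hF.continuousAt V V')⟩

theorem SmoothAlongAt.smul {g : M → ℝ} (hg : ContMDiffAt 𝓘(ℝ, E) 𝓘(ℝ, ℝ) ∞ g p)
    (hV : SmoothAlongAt E F V p) : SmoothAlongAt E F (fun x ↦ g x • V x) p := by
  obtain ⟨hF, hcoord⟩ := smoothAlongAt_iff.1 hV
  exact smoothAlongAt_iff.2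
    ⟨hF, (hg.smul hcoord).congr_of_eventuallyEq (coordAlong_smul hF.continuousAt g V)⟩

theorem SmoothAlongAt.sub (hV : SmoothAlongAt E F V p) (hV' : SmoothAlongAt E F V' p) :
    SmoothAlongAt E F (fun x ↦ V x - V' x) p := by
  simpa only [neg_one_smul, ← sub_eq_add_neg] using
    hV.add (hV'.smul (contMDiffAt_const (c := (-1 : ℝ))))

theorem SmoothAlongAt.congr (hV : SmoothAlongAt E F V p) (h : ∀ᶠ x in nhds p, V x = V' x) :
    SmoothAlongAt E F V' p := by
  refine ContMDiffAt.congr_of_eventuallyEq hV ?_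
  filter_upwards [h] with x hx
  rw [hx]

theorem SmoothAlongAt.contMDiffAt_inner [RiemannianBundle (fun y : N ↦ TangentSpace 𝓘(ℝ, E') y)]
    [IsContMDiffRiemannianBundle 𝓘(ℝ, E') ∞ E' (fun y : N ↦ TangentSpace 𝓘(ℝ, E') y)]
    (hV : SmoothAlongAt E F V p) (hV' : SmoothAlongAt E F V' p) :
    ContMDiffAt 𝓘(ℝ, E) 𝓘(ℝ, ℝ) ∞ (fun x ↦ (inner ℝ (V x) (V' x) : ℝ)) p :=
  ContMDiffAt.inner_bundle (F := E') (E := fun y : N ↦ TangentSpace 𝓘(ℝ, E') y) hV hV'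

variable [FiniteDimensional ℝ E']

theorem SmoothAlongAt.exists_eventually_eq_sum (hV : SmoothAlongAt E F V p) :
    ∃ (n : ℕ) (c : Fin n → M → ℝ) (W : Fin n → Π y : N, TangentSpace 𝓘(ℝ, E') y),
      (∀ i, ContMDiffAt 𝓘(ℝ, E) 𝓘(ℝ, ℝ) ∞ (c i) p) ∧ (∀ i, CMDiffAt ∞ (T% (W i)) (F p)) ∧
        ∀ᶠ x in nhds p, V x = ∑ i, c i x • W i (F x) := by
  obtain ⟨hF, hcoord⟩ := smoothAlongAt_iff.1 hV
  set e := trivializationAt E' (TangentSpace 𝓘(ℝ, E')) (F p)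
  have hp : F p ∈ e.baseSet := FiberBundle.mem_baseSet_trivializationAt' (F p)
  let b := Module.finBasis ℝ E'
  refine ⟨_, fun i x ↦ b.coord i (coordAlong F (F p) V x), e.localFrame b, fun i ↦ ?_,
    fun i ↦ contMDiffAt_localFrame_of_mem (I := 𝓘(ℝ, E')) ∞ e b i hp, ?_⟩
  · exact (LinearMap.toContinuousLinearMap (b.coord i)).contDiff.contDiffAt.contMDiffAt.comp p
      hcoord
  filter_upwards [eventually_mem_baseSet (E' := E') hF.continuousAt] with x hx
  have hsum := e.eq_sum_localFrameCoeff_smul (I := 𝓘(ℝ, E')) (b := b) (s := extend E' (V x)) hx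
  have hcoeff i := e.localFrameCoeff_eq_coeff (I := 𝓘(ℝ, E')) (b := b) (s := extend E' (V x)) hx
    (i := i)
  simp only [extend_apply_self] at hsum hcoeff
  exact hsum.trans (Finset.sum_congr rfl fun i _ ↦ by rw [hcoeff]; rfl)

theorem SmoothAlongAt.induction {P : (Π x : M, TangentSpace 𝓘(ℝ, E') (F x)) → Prop}
    (comp : ∀ W : Π y : N, TangentSpace 𝓘(ℝ, E') y, CMDiffAt ∞ (T% W) (F p) →
      P (fun x ↦ W (F x)))
    (add : ∀ V V', SmoothAlongAt E F V p → SmoothAlongAt E F V' p → P V → P V' →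
      P (fun x ↦ V x + V' x))
    (smul : ∀ (g : M → ℝ) V, ContMDiffAt 𝓘(ℝ, E) 𝓘(ℝ, ℝ) ∞ g p → SmoothAlongAt E F V p → P V →
      P (fun x ↦ g x • V x))
    (congr : ∀ V V', (∀ᶠ x in nhds p, V x = V' x) → P V → P V') (hV : SmoothAlongAt E F V p) :
    P V := by
  have hF := hV.contMDiffAt_base
  obtain ⟨n, c, W, hc, hW, hsum⟩ := hV.exists_eventually_eq_sum
  have partialSum : ∀ s : Finset (Fin n), SmoothAlongAt E F (fun x ↦ ∑ i ∈ s, c i x • W i (F x)) p ∧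
      P (fun x ↦ ∑ i ∈ s, c i x • W i (F x)) := by
    intro s
    induction s using Finset.induction_on with
    | empty =>
      have hzero : CMDiffAt ∞ (T% (0 : Π y : N, TangentSpace 𝓘(ℝ, E') y)) (F p) :=
        (contMDiff_zeroSection ℝ (TangentSpace 𝓘(ℝ, E') : N → Type _)).contMDiffAt
      simp only [Finset.sum_empty]
      exact ⟨smoothAlongAt_comp hF hzero, comp _ hzero⟩
    | insert i s hi ih =>
      have hWi := smoothAlongAt_comp hF (hW i)
      have hcWi := hWi.smul (hc i)
      simp only [Finset.sum_insert hi]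
      exact ⟨hcWi.add ih.1, add _ _ hcWi ih.1 (smul _ _ (hc i) hWi (comp _ (hW i))) ih.2⟩
  exact congr _ _ (hsum.mono fun _ h ↦ h.symm) (partialSum Finset.univ).2

end Along

/-! ### The pulled back connection -/

section Extend

variable {E : Type*} [NormedAddCommGroup E] [NormedSpace ℝ E]
  {M : Type*} [TopologicalSpace M] [ChartedSpace E M] [IsManifold 𝓘(ℝ, E) ∞ M] {p : M}

theorem eventually_extend_eq_symmL (p : M) :
    ∀ᶠ x in nhds p, ∀ v : TangentSpace 𝓘(ℝ, E) p,
      extend E v x = (trivializationAt E (TangentSpace 𝓘(ℝ, E)) p).symmL ℝ x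
        ((trivializationAt E (TangentSpace 𝓘(ℝ, E)) p).continuousLinearMapAt ℝ p v) := by
  set e := trivializationAt E (TangentSpace 𝓘(ℝ, E)) p
  have hp : p ∈ e.baseSet := FiberBundle.mem_baseSet_trivializationAt' p
  filter_upwards [e.open_baseSet.mem_nhds hp] with x hx v
  rw [e.symmL_apply hx, e.continuousLinearMapAt_apply_of_mem ℝ hp]
  rfl

theorem trivializationAt_snd_eq {q x : M} (hx : x ∈ (chartAt E q).source)
    (v : TangentSpace 𝓘(ℝ, E) x) :
    (trivializationAt E (TangentSpace 𝓘(ℝ, E)) q ⟨x, v⟩).2 =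
      mvfderiv 𝓘(ℝ, E) (extChartAt 𝓘(ℝ, E) q) x v := by
  rw [← (trivializationAt E (TangentSpace 𝓘(ℝ, E)) q).continuousLinearMapAt_apply_of_mem ℝ hx,
    TangentBundle.continuousLinearMapAt_trivializationAt hx]
  rfl

theorem coordAlong_mfderiv {E' : Type*} [NormedAddCommGroup E'] [NormedSpace ℝ E']
    {N : Type*} [TopologicalSpace N] [ChartedSpace E' N] [IsManifold 𝓘(ℝ, E') ∞ N] {F : M → N}
    (hF : ContMDiffAt 𝓘(ℝ, E) 𝓘(ℝ, E') ∞ F p)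
    (Z : Π x : M, TangentSpace 𝓘(ℝ, E) x) :
    coordAlong F (F p) (fun x ↦ mfderiv 𝓘(ℝ, E) 𝓘(ℝ, E') F x (Z x)) =ᶠ[nhds p]
      fun x ↦ mvfderiv 𝓘(ℝ, E) (extChartAt 𝓘(ℝ, E') (F p) ∘ F) x (Z x) := by
  filter_upwards [eventually_mdifferentiableAt hF,
    hF.continuousAt.eventually (chart_source_mem_nhds E' (F p))] with x hFx hx
  rw [coordAlong, trivializationAt_snd_eq hx]
  exact (mfderiv_comp_apply x (mdifferentiableAt_extChartAt hx) hFx (Z x)).symm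

variable [FiniteDimensional ℝ E]

theorem mlieBracket_extend (v w : TangentSpace 𝓘(ℝ, E) p) :
    mlieBracket 𝓘(ℝ, E) (extend E v) (extend E w) p = 0 := by
  -- Both fields have constant coordinates in the chart at `p`.
  have hconst : ∀ v : TangentSpace 𝓘(ℝ, E) p, mvfderiv 𝓘(ℝ, E)
      (fun x ↦ mvfderiv 𝓘(ℝ, E) (extChartAt 𝓘(ℝ, E) p) x (extend E v x)) p = 0 := by
    intro v
    have hcoord : (fun x ↦ mvfderiv 𝓘(ℝ, E) (extChartAt 𝓘(ℝ, E) p) x (extend E v x)) =ᶠ[nhds p]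
        fun _ ↦ (trivializationAt E (TangentSpace 𝓘(ℝ, E)) p ⟨p, v⟩).2 := by
      filter_upwards [chart_source_mem_nhds E p] with x hx
      rw [← trivializationAt_snd_eq hx]
      exact (congrArg Prod.snd ((trivializationAt E (TangentSpace 𝓘(ℝ, E)) p).apply_mk_symm hx
        (trivializationAt E (TangentSpace 𝓘(ℝ, E)) p ⟨p, v⟩).2) :)
    rw [mvfderiv_congr_of_eventuallyEq hcoord, mvfderiv_const]
  have h := mvfderiv_mlieBracket (contMDiffAt_extChartAt (I := 𝓘(ℝ, E)) (n := ∞) (x := p))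
    (contMDiffAt_extend (k := ∞) 𝓘(ℝ, E) E v) (contMDiffAt_extend (k := ∞) 𝓘(ℝ, E) E w)
  rw [hconst, hconst, zero_apply, zero_apply, sub_zero] at h
  exact (isInvertible_mfderiv_extChartAt (I := 𝓘(ℝ, E)) (mem_extChartAt_source p)).injective
    (h.trans (map_zero _).symm)

variable [RiemannianBundle (fun x : M ↦ TangentSpace 𝓘(ℝ, E) x)]
  [IsContMDiffRiemannianBundle 𝓘(ℝ, E) ∞ E (fun x : M ↦ TangentSpace 𝓘(ℝ, E) x)]

theorem isLinearMap_leviCivita_extend (p : M) :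
    IsLinearMap ℝ (fun v : TangentSpace 𝓘(ℝ, E) p ↦ leviCivita (extend E v) p) where
  map_add v w := by
    have hv := mdifferentiableAt_extend 𝓘(ℝ, E) E v
    have hw := mdifferentiableAt_extend 𝓘(ℝ, E) E w
    rw [← leviCivita.isCovariantDerivativeOn.add hv hw]
    refine leviCivita.isCovariantDerivativeOn.congr_of_eventuallyEq (s := Set.univ)
      (mdifferentiableAt_extend 𝓘(ℝ, E) E _) (mdifferentiableAt_add_section hv hw)
      Filter.univ_mem ?_
    filter_upwards [eventually_extend_eq_symmL (E := E) p] with x hx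
    simp only [Pi.add_apply, hx, map_add]
  map_smul a v := by
    have hv := mdifferentiableAt_extend 𝓘(ℝ, E) E v
    rw [← leviCivita.isCovariantDerivativeOn.smul_const a hv]
    refine leviCivita.isCovariantDerivativeOn.congr_of_eventuallyEq (s := Set.univ)
      (mdifferentiableAt_extend 𝓘(ℝ, E) E _) (mdifferentiableAt_const.smul_section hv)
      Filter.univ_mem ?_
    filter_upwards [eventually_extend_eq_symmL (E := E) p] with x hx
    simp only [Pi.smul_apply, hx, map_smul]

end Extend

section CovAlong

variable {E : Type*} [NormedAddCommGroup E] [NormedSpace ℝ E]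
  {M : Type*} [TopologicalSpace M] [ChartedSpace E M]
  {E' : Type*} [NormedAddCommGroup E'] [NormedSpace ℝ E'] [FiniteDimensional ℝ E']
  {N : Type*} [TopologicalSpace N] [ChartedSpace E' N] [IsManifold 𝓘(ℝ, E') ∞ N]
  [RiemannianBundle (fun y : N ↦ TangentSpace 𝓘(ℝ, E') y)]
  [IsContMDiffRiemannianBundle 𝓘(ℝ, E') ∞ E' (fun y : N ↦ TangentSpace 𝓘(ℝ, E') y)]
  {F : M → N} {p : M} {V V' : Π x : M, TangentSpace 𝓘(ℝ, E') (F x)}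

theorem covAlong_apply (V : Π x : M, TangentSpace 𝓘(ℝ, E') (F x)) (u : TangentSpace 𝓘(ℝ, E) p) :
    covAlong E E' F V p u =
      (trivializationAt E' (TangentSpace 𝓘(ℝ, E')) (F p)).symmL ℝ (F p)
        (mvfderiv 𝓘(ℝ, E) (coordAlong F (F p) V) p u)
      + leviCivita (extend E' (V p)) (F p) (mfderiv 𝓘(ℝ, E) 𝓘(ℝ, E') F p u) := rfl

theorem covAlong_congr (h : ∀ᶠ x in nhds p, V x = V' x) :
    covAlong E E' F V p = covAlong E E' F V' p := by
  have hcoord : coordAlong F (F p) V =ᶠ[nhds p] coordAlong F (F p) V' := by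
    filter_upwards [h] with x hx
    rw [coordAlong, coordAlong, hx]
  ext u
  rw [covAlong_apply, covAlong_apply, mvfderiv_congr_of_eventuallyEq hcoord, h.self_of_nhds]

theorem covAlong_add (hV : DiffAlongAt E F V p) (hV' : DiffAlongAt E F V' p)
    (u : TangentSpace 𝓘(ℝ, E) p) :
    covAlong E E' F (fun x ↦ V x + V' x) p u =
      covAlong E E' F V p u + covAlong E E' F V' p u := by
  obtain ⟨hF, hcoord⟩ := diffAlongAt_iff.1 hV
  simp only [covAlong_apply]
  rw [mvfderiv_congr_of_eventuallyEq (coordAlong_add hF.continuousAt V V'),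
    mvfderiv_add hcoord (diffAlongAt_iff.1 hV').2, (isLinearMap_leviCivita_extend _).map_add]
  simp only [add_apply, map_add]
  abel

theorem covAlong_zero (hF : MDifferentiableAt 𝓘(ℝ, E) 𝓘(ℝ, E') F p) :
    covAlong E E' F (fun _ ↦ 0) p = 0 := by
  have hzero : DiffAlongAt E F (fun _ ↦ 0) p :=
    (mdifferentiableAt_zeroSection ℝ (TangentSpace 𝓘(ℝ, E') : N → Type _)).comp p hF
  ext u
  simpa using covAlong_add hzero hzero u

theorem covAlong_smul {g : M → ℝ} (hg : MDifferentiableAt 𝓘(ℝ, E) 𝓘(ℝ, ℝ) g p)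
    (hV : DiffAlongAt E F V p) (u : TangentSpace 𝓘(ℝ, E) p) :
    covAlong E E' F (fun x ↦ g x • V x) p u =
      g p • covAlong E E' F V p u + mvfderiv 𝓘(ℝ, E) g p u • V p := by
  obtain ⟨hF, hcoord⟩ := diffAlongAt_iff.1 hV
  have hleibniz : mvfderiv 𝓘(ℝ, E) (coordAlong F (F p) (fun x ↦ g x • V x)) p u =
      g p • mvfderiv 𝓘(ℝ, E) (coordAlong F (F p) V) p u
        + mvfderiv 𝓘(ℝ, E) g p u • coordAlong F (F p) V p := by
    rw [mvfderiv_congr_of_eventuallyEq (coordAlong_smul hF.continuousAt g V),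
      mvfderiv_smul hg hcoord]
    rfl
  have hcoordV : (trivializationAt E' (TangentSpace 𝓘(ℝ, E')) (F p)).symmL ℝ (F p)
      (coordAlong F (F p) V p) = V p := symmL_trivializationAt_snd (V p)
  simp only [covAlong_apply]
  rw [hleibniz, (isLinearMap_leviCivita_extend _).map_smul, map_add, map_smul, map_smul, hcoordV,
    smul_apply, smul_add]
  abel

theorem covAlong_metric_of_comp {u : TangentSpace 𝓘(ℝ, E) p} (hV' : SmoothAlongAt E F V' p)
    (hcomp : ∀ W : Π y : N, TangentSpace 𝓘(ℝ, E') y, CMDiffAt ∞ (T% W) (F p) →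
      mvfderiv 𝓘(ℝ, E) (fun x ↦ (inner ℝ (W (F x)) (V' x) : ℝ)) p u =
        inner ℝ (covAlong E E' F (fun x ↦ W (F x)) p u) (V' p)
          + inner ℝ (W (F p)) (covAlong E E' F V' p u))
    (hV : SmoothAlongAt E F V p) :
    mvfderiv 𝓘(ℝ, E) (fun x ↦ (inner ℝ (V x) (V' x) : ℝ)) p u =
      inner ℝ (covAlong E E' F V p u) (V' p) + inner ℝ (V p) (covAlong E E' F V' p u) := by
  have hdiff : ∀ {U : Π x : M, TangentSpace 𝓘(ℝ, E') (F x)}, SmoothAlongAt E F U p →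
      MDifferentiableAt 𝓘(ℝ, E) 𝓘(ℝ, ℝ) (fun x ↦ (inner ℝ (U x) (V' x) : ℝ)) p :=
    fun hU ↦ (hU.contMDiffAt_inner hV').mdifferentiableAt (by simp)
  refine SmoothAlongAt.induction (P := fun V ↦
      mvfderiv 𝓘(ℝ, E) (fun x ↦ (inner ℝ (V x) (V' x) : ℝ)) p u =
        inner ℝ (covAlong E E' F V p u) (V' p) + inner ℝ (V p) (covAlong E E' F V' p u))
    hcomp (fun V₁ V₂ hV₁ hV₂ h₁ h₂ ↦ ?_) (fun g V₁ hg hV₁ h₁ ↦ ?_) (fun V₁ V₂ h h₁ ↦ ?_) hV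
  · simp only [inner_add_left]
    rw [mvfderiv_fun_add (hdiff hV₁) (hdiff hV₂), add_apply, h₁, h₂,
      covAlong_add hV₁.diffAlongAt hV₂.diffAlongAt, inner_add_left]
    abel
  · have hg' : MDifferentiableAt 𝓘(ℝ, E) 𝓘(ℝ, ℝ) g p := hg.mdifferentiableAt (by simp)
    simp only [real_inner_smul_left]
    rw [mvfderiv_fun_mul hg' (hdiff hV₁), add_apply, smul_apply, smul_apply, h₁,
      covAlong_smul hg' hV₁.diffAlongAt, inner_add_left]
    simp only [real_inner_smul_left, smul_eq_mul]
    ring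
  · have hinner : (fun x ↦ (inner ℝ (V₁ x) (V' x) : ℝ)) =ᶠ[nhds p]
        fun x ↦ (inner ℝ (V₂ x) (V' x) : ℝ) := by
      filter_upwards [h] with x hx
      rw [hx]
    rw [← mvfderiv_congr_of_eventuallyEq hinner, h₁, covAlong_congr h, h.self_of_nhds]

theorem smoothAlongAt_leviCivita {W : Π y : N, TangentSpace 𝓘(ℝ, E') y}
    (hW : CMDiffAt ∞ (T% W) (F p)) (hV : SmoothAlongAt E F V p) :
    SmoothAlongAt E F (fun x ↦ leviCivita W (F x) (V x)) p := by
  have hF := hV.contMDiffAt_base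
  refine SmoothAlongAt.induction
    (P := fun V ↦ SmoothAlongAt E F (fun x ↦ leviCivita W (F x) (V x)) p)
    (fun W' hW' ↦ ?_) (fun V₁ V₂ _ _ h₁ h₂ ↦ ?_) (fun g V₁ hg _ h₁ ↦ ?_) (fun V₁ V₂ h h₁ ↦ ?_) hV
  · exact smoothAlongAt_comp hF (contMDiffAt_leviCivita hW' hW)
  · simpa only [map_add] using h₁.add h₂
  · simpa only [map_smul] using h₁.smul hg
  · exact h₁.congr (h.mono fun x hx ↦ by rw [hx])

section Metric

variable [FiniteDimensional ℝ E] [RiemannianBundle (fun x : M ↦ TangentSpace 𝓘(ℝ, E) x)]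

theorem covAlong_comp_apply (hF : MDifferentiableAt 𝓘(ℝ, E) 𝓘(ℝ, E') F p)
    {W : Π y : N, TangentSpace 𝓘(ℝ, E') y} (hW : MDiffAt (T% W) (F p))
    (u : TangentSpace 𝓘(ℝ, E) p) :
    covAlong E E' F (fun x ↦ W (F x)) p u =
      leviCivita W (F p) (mfderiv 𝓘(ℝ, E) 𝓘(ℝ, E') F p u) := by
  rw [covAlong_comp E E' F p hF W hW, ContinuousLinearMap.comp_apply]

theorem covAlong_metric_comp (hF : MDifferentiableAt 𝓘(ℝ, E) 𝓘(ℝ, E') F p)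
    {W W' : Π y : N, TangentSpace 𝓘(ℝ, E') y} (hW : MDiffAt (T% W) (F p))
    (hW' : MDiffAt (T% W') (F p)) (u : TangentSpace 𝓘(ℝ, E) p) :
    mvfderiv 𝓘(ℝ, E) (fun x ↦ (inner ℝ (W (F x)) (W' (F x)) : ℝ)) p u =
      inner ℝ (covAlong E E' F (fun x ↦ W (F x)) p u) (W' (F p))
        + inner ℝ (W (F p)) (covAlong E E' F (fun x ↦ W' (F x)) p u) := by
  have hmetric := leviCivita_metric
    (mdifferentiableAt_extend 𝓘(ℝ, E') E' (mfderiv 𝓘(ℝ, E) 𝓘(ℝ, E') F p u)) hW hW'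
  rw [extend_apply_self] at hmetric
  rw [covAlong_comp_apply hF hW, covAlong_comp_apply hF hW', ← hmetric]
  exact mvfderiv_comp_apply p (mdifferentiableAt_inner hW hW') hF u

theorem covAlong_metric (hV : SmoothAlongAt E F V p) (hV' : SmoothAlongAt E F V' p)
    (u : TangentSpace 𝓘(ℝ, E) p) :
    mvfderiv 𝓘(ℝ, E) (fun x ↦ (inner ℝ (V x) (V' x) : ℝ)) p u =
      inner ℝ (covAlong E E' F V p u) (V' p) + inner ℝ (V p) (covAlong E E' F V' p u) := by
  have hF := hV.contMDiffAt_base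
  refine covAlong_metric_of_comp hV' (fun W hW ↦ ?_) hV
  have h := covAlong_metric_of_comp (smoothAlongAt_comp hF hW) (fun W' hW' ↦ covAlong_metric_comp
    (hF.mdifferentiableAt (by simp)) (hW'.mdifferentiableAt (by simp))
    (hW.mdifferentiableAt (by simp)) u) hV'
  simpa only [real_inner_comm, add_comm] using h

variable [IsManifold 𝓘(ℝ, E) ∞ M]

theorem smoothAlongAt_covAlong (hV : SmoothAlongAt E F V p)
    {X : Π x : M, TangentSpace 𝓘(ℝ, E) x} (hX : CMDiffAt ∞ (T% X) p) :
    SmoothAlongAt E F (fun x ↦ covAlong E E' F V x (X x)) p := by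
  have hF := hV.contMDiffAt_base
  refine SmoothAlongAt.induction
    (P := fun V ↦ SmoothAlongAt E F (fun x ↦ covAlong E E' F V x (X x)) p)
    (fun W hW ↦ ?_) (fun V₁ V₂ hV₁ hV₂ h₁ h₂ ↦ ?_) (fun g V₁ hg hV₁ h₁ ↦ ?_)
    (fun V₁ V₂ h h₁ ↦ ?_) hV
  · refine (smoothAlongAt_leviCivita hW (contMDiffAt_mfderiv_apply hF hX)).congr ?_
    filter_upwards [eventually_mdifferentiableAt hF,
      hF.continuousAt.eventually (eventually_mdifferentiableAt hW)] with x hFx hWx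
    exact (covAlong_comp_apply hFx hWx (X x)).symm
  · refine (h₁.add h₂).congr ?_
    filter_upwards [eventually_mdifferentiableAt hV₁, eventually_mdifferentiableAt hV₂]
      with x hx₁ hx₂
    exact (covAlong_add hx₁ hx₂ (X x)).symm
  · refine ((h₁.smul hg).add (hV₁.smul (contMDiffAt_mvfderiv_apply hg hX))).congr ?_
    filter_upwards [eventually_mdifferentiableAt hg, eventually_mdifferentiableAt hV₁]
      with x hgx hx₁
    exact (covAlong_smul hgx hx₁ (X x)).symm
  · exact h₁.congr (h.eventually_nhds.mono fun x hx ↦ by rw [covAlong_congr hx])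

end Metric

theorem covAlong_mfderiv_sub [CompleteSpace E] [IsManifold 𝓘(ℝ, E) ∞ M]
    (hF : ContMDiffAt 𝓘(ℝ, E) 𝓘(ℝ, E') ∞ F p)
    {X Y : Π x : M, TangentSpace 𝓘(ℝ, E) x} (hX : CMDiffAt ∞ (T% X) p)
    (hY : CMDiffAt ∞ (T% Y) p) :
    covAlong E E' F (fun x ↦ mfderiv 𝓘(ℝ, E) 𝓘(ℝ, E') F x (Y x)) p (X p)
      - covAlong E E' F (fun x ↦ mfderiv 𝓘(ℝ, E) 𝓘(ℝ, E') F x (X x)) p (Y p)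
      = mfderiv 𝓘(ℝ, E) 𝓘(ℝ, E') F p (mlieBracket 𝓘(ℝ, E) X Y p) := by
  have htorsion := leviCivita_torsion
    (mdifferentiableAt_extend 𝓘(ℝ, E') E' (mfderiv 𝓘(ℝ, E) 𝓘(ℝ, E') F p (X p)))
    (mdifferentiableAt_extend 𝓘(ℝ, E') E' (mfderiv 𝓘(ℝ, E) 𝓘(ℝ, E') F p (Y p)))
  rw [mlieBracket_extend, extend_apply_self, extend_apply_self] at htorsion
  have hbracket := mvfderiv_mlieBracket (contMDiffAt_extChartAt.comp p hF) hX hY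
  have hcoord := (coordAlong_mfderiv hF (mlieBracket 𝓘(ℝ, E) X Y)).self_of_nhds
  rw [covAlong_apply, covAlong_apply, mvfderiv_congr_of_eventuallyEq (coordAlong_mfderiv hF Y),
    mvfderiv_congr_of_eventuallyEq (coordAlong_mfderiv hF X), add_sub_add_comm, htorsion, add_zero,
    ← map_sub, ← hbracket]
  exact (congrArg ((trivializationAt E' (TangentSpace 𝓘(ℝ, E')) (F p)).symmL ℝ (F p))
    hcoord.symm).trans (symmL_trivializationAt_snd _)

section Kahler

variable {J : Π y : N, TangentSpace 𝓘(ℝ, E') y →L[ℝ] TangentSpace 𝓘(ℝ, E') y}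

theorem IsKahler.inner_left (hJ : IsKahler J) {q : N} (v w : TangentSpace 𝓘(ℝ, E') q) :
    (inner ℝ (J q v) w : ℝ) = -inner ℝ v (J q w) := by
  rw [← hJ.inner_map, hJ.sq, inner_neg_left]

theorem IsKahler.smoothAlongAt (hJ : IsKahler J) (hV : SmoothAlongAt E F V p) :
    SmoothAlongAt E F (fun x ↦ J (F x) (V x)) p :=
  ContMDiffAt.clm_bundle_apply (F₁ := E') (F₂ := E')
    (E₁ := fun y : N ↦ TangentSpace 𝓘(ℝ, E') y) (E₂ := fun y : N ↦ TangentSpace 𝓘(ℝ, E') y)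
    (b := F) (ϕ := fun x ↦ J (F x)) (hJ.contMDiff.contMDiffAt.comp p hV.contMDiffAt_base) hV

variable [FiniteDimensional ℝ E] [RiemannianBundle (fun x : M ↦ TangentSpace 𝓘(ℝ, E) x)]

theorem IsKahler.covAlong_comp (hJ : IsKahler J) (hF : MDifferentiableAt 𝓘(ℝ, E) 𝓘(ℝ, E') F p)
    {W : Π y : N, TangentSpace 𝓘(ℝ, E') y} (hW : CMDiffAt ∞ (T% W) (F p))
    (u : TangentSpace 𝓘(ℝ, E) p) :
    covAlong E E' F (fun x ↦ J (F x) (W (F x))) p u =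
      J (F p) (covAlong E E' F (fun x ↦ W (F x)) p u) := by
  have hW' : MDiffAt (T% W) (F p) := hW.mdifferentiableAt (by simp)
  have hJW : MDiffAt (T% (fun y ↦ J y (W y))) (F p) :=
    (hJ.smoothAlongAt (F := id) hW).mdifferentiableAt (by simp)
  rw [covAlong_comp_apply hF hW', ← hJ.parallel _ _ hW']
  exact covAlong_comp_apply (W := fun y ↦ J y (W y)) hF hJW u

theorem IsKahler.covAlong_apply (hJ : IsKahler J) (hV : SmoothAlongAt E F V p)
    (u : TangentSpace 𝓘(ℝ, E) p) :
    covAlong E E' F (fun x ↦ J (F x) (V x)) p u = J (F p) (covAlong E E' F V p u) := by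
  refine SmoothAlongAt.induction
    (P := fun V ↦ covAlong E E' F (fun x ↦ J (F x) (V x)) p u = J (F p) (covAlong E E' F V p u))
    (fun W hW ↦ hJ.covAlong_comp (hV.contMDiffAt_base.mdifferentiableAt (by simp)) hW u)
    (fun V₁ V₂ hV₁ hV₂ h₁ h₂ ↦ ?_) (fun g V₁ hg hV₁ h₁ ↦ ?_) (fun V₁ V₂ h h₁ ↦ ?_) hV
  · simp only [map_add]
    rw [covAlong_add (hJ.smoothAlongAt hV₁).diffAlongAt (hJ.smoothAlongAt hV₂).diffAlongAt, h₁, h₂,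
      covAlong_add hV₁.diffAlongAt hV₂.diffAlongAt, map_add]
  · have hg' : MDifferentiableAt 𝓘(ℝ, E) 𝓘(ℝ, ℝ) g p := hg.mdifferentiableAt (by simp)
    simp only [map_smul]
    rw [covAlong_smul hg' (hJ.smoothAlongAt hV₁).diffAlongAt, h₁,
      covAlong_smul hg' hV₁.diffAlongAt, map_add, map_smul, map_smul]
  · have hJV : ∀ᶠ x in nhds p, J (F x) (V₂ x) = J (F x) (V₁ x) := by
      filter_upwards [h] with x hx
      rw [hx]
    rw [covAlong_congr hJV, h₁, covAlong_congr h]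

end Kahler

end CovAlong

/-! ### The second fundamental form -/

section SecondFundamentalForm

variable {E : Type*} [NormedAddCommGroup E] [NormedSpace ℝ E] [FiniteDimensional ℝ E]
  {M : Type*} [TopologicalSpace M] [ChartedSpace E M] [IsManifold 𝓘(ℝ, E) ∞ M]
  [RiemannianBundle (fun x : M ↦ TangentSpace 𝓘(ℝ, E) x)]
  [IsContMDiffRiemannianBundle 𝓘(ℝ, E) ∞ E (fun x : M ↦ TangentSpace 𝓘(ℝ, E) x)]
  {E' : Type*} [NormedAddCommGroup E'] [NormedSpace ℝ E'] [FiniteDimensional ℝ E']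
  {N : Type*} [TopologicalSpace N] [ChartedSpace E' N] [IsManifold 𝓘(ℝ, E') ∞ N]
  [RiemannianBundle (fun y : N ↦ TangentSpace 𝓘(ℝ, E') y)]
  [IsContMDiffRiemannianBundle 𝓘(ℝ, E') ∞ E' (fun y : N ↦ TangentSpace 𝓘(ℝ, E') y)]
  {F : M → N} {p : M}

theorem tensorialAt_secondFundamentalForm (hF : ContMDiffAt 𝓘(ℝ, E) 𝓘(ℝ, E') ∞ F p)
    (X : Π x : M, TangentSpace 𝓘(ℝ, E) x) :
    TensorialAt 𝓘(ℝ, E) E (fun Y ↦ secondFundamentalForm E E' F X Y p) p where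
  smul {f Y} hf hY := by
    have hcov : covAlong E E' F (fun x ↦ mfderiv 𝓘(ℝ, E) 𝓘(ℝ, E') F x ((f • Y) x)) p (X p) =
        f p • covAlong E E' F (fun x ↦ mfderiv 𝓘(ℝ, E) 𝓘(ℝ, E') F x (Y x)) p (X p)
          + mvfderiv 𝓘(ℝ, E) f p (X p) • mfderiv 𝓘(ℝ, E) 𝓘(ℝ, E') F p (Y p) := by
      simp only [Pi.smul_apply', map_smul]
      exact covAlong_smul hf (diffAlongAt_mfderiv hF hY) (X p)
    rw [secondFundamentalForm, secondFundamentalForm, hcov,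
      leviCivita.isCovariantDerivativeOn.leibniz hY hf, add_apply, smul_apply,
      ContinuousLinearMap.smulRight_apply, map_add, map_smul, map_smul, smul_sub]
    abel
  add {Y Y'} hY hY' := by
    have hcov : covAlong E E' F (fun x ↦ mfderiv 𝓘(ℝ, E) 𝓘(ℝ, E') F x ((Y + Y') x)) p (X p) =
        covAlong E E' F (fun x ↦ mfderiv 𝓘(ℝ, E) 𝓘(ℝ, E') F x (Y x)) p (X p)
          + covAlong E E' F (fun x ↦ mfderiv 𝓘(ℝ, E) 𝓘(ℝ, E') F x (Y' x)) p (X p) := by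
      simp only [Pi.add_apply, map_add]
      exact covAlong_add (diffAlongAt_mfderiv hF hY) (diffAlongAt_mfderiv hF hY') (X p)
    rw [secondFundamentalForm, secondFundamentalForm, secondFundamentalForm, hcov,
      leviCivita.isCovariantDerivativeOn.add hY hY', add_apply, map_add]
    abel

theorem secondFundamentalForm_eq_at (hF : ContMDiffAt 𝓘(ℝ, E) 𝓘(ℝ, E') ∞ F p)
    (X : Π x : M, TangentSpace 𝓘(ℝ, E) x) {Y : Π x : M, TangentSpace 𝓘(ℝ, E) x}
    (hY : MDiffAt (T% Y) p) :
    secondFundamentalForm E E' F X Y p = secondFundamentalFormAt E E' F p (X p) (Y p) := by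
  have hpointwise := (tensorialAt_secondFundamentalForm hF X).pointwise hY
    (mdifferentiableAt_extend 𝓘(ℝ, E) E (Y p)) (extend_apply_self (F := E) (Y p)).symm
  rw [hpointwise, secondFundamentalFormAt, secondFundamentalForm, secondFundamentalForm,
    extend_apply_self]

theorem covAlong_mfderiv (hF : ContMDiffAt 𝓘(ℝ, E) 𝓘(ℝ, E') ∞ F p)
    {Y : Π x : M, TangentSpace 𝓘(ℝ, E) x} (hY : MDiffAt (T% Y) p) (u : TangentSpace 𝓘(ℝ, E) p) :
    covAlong E E' F (fun x ↦ mfderiv 𝓘(ℝ, E) 𝓘(ℝ, E') F x (Y x)) p u =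
      mfderiv 𝓘(ℝ, E) 𝓘(ℝ, E') F p (leviCivita Y p u)
        + secondFundamentalFormAt E E' F p u (Y p) := by
  have hform := secondFundamentalForm_eq_at hF (extend E u) hY
  rw [secondFundamentalForm, extend_apply_self] at hform
  rw [← hform]
  abel

theorem secondFundamentalFormAt_add_left (u u' v : TangentSpace 𝓘(ℝ, E) p) :
    secondFundamentalFormAt E E' F p (u + u') v =
      secondFundamentalFormAt E E' F p u v + secondFundamentalFormAt E E' F p u' v := by
  simp only [secondFundamentalFormAt, secondFundamentalForm, extend_apply_self, map_add]
  abel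

theorem secondFundamentalFormAt_smul_left (a : ℝ) (u v : TangentSpace 𝓘(ℝ, E) p) :
    secondFundamentalFormAt E E' F p (a • u) v = a • secondFundamentalFormAt E E' F p u v := by
  simp only [secondFundamentalFormAt, secondFundamentalForm, extend_apply_self, map_smul, smul_sub]

theorem secondFundamentalFormAt_comm (hF : ContMDiffAt 𝓘(ℝ, E) 𝓘(ℝ, E') ∞ F p)
    (u v : TangentSpace 𝓘(ℝ, E) p) :
    secondFundamentalFormAt E E' F p u v = secondFundamentalFormAt E E' F p v u := by
  have hu := contMDiffAt_extend (k := ∞) 𝓘(ℝ, E) E u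
  have hv := contMDiffAt_extend (k := ∞) 𝓘(ℝ, E) E v
  have htorsion := covAlong_mfderiv_sub hF hu hv
  rw [← leviCivita_torsion (hu.mdifferentiableAt (by simp)) (hv.mdifferentiableAt (by simp)),
    map_sub] at htorsion
  rw [← sub_eq_zero, secondFundamentalFormAt, secondFundamentalFormAt, secondFundamentalForm,
    secondFundamentalForm, sub_sub_sub_comm, htorsion, sub_self]

theorem secondFundamentalFormAt_add_right (hF : ContMDiffAt 𝓘(ℝ, E) 𝓘(ℝ, E') ∞ F p)
    (u v v' : TangentSpace 𝓘(ℝ, E) p) :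
    secondFundamentalFormAt E E' F p u (v + v') =
      secondFundamentalFormAt E E' F p u v + secondFundamentalFormAt E E' F p u v' := by
  rw [secondFundamentalFormAt_comm hF, secondFundamentalFormAt_add_left,
    secondFundamentalFormAt_comm hF v, secondFundamentalFormAt_comm hF v']

theorem secondFundamentalFormAt_smul_right (hF : ContMDiffAt 𝓘(ℝ, E) 𝓘(ℝ, E') ∞ F p)
    (a : ℝ) (u v : TangentSpace 𝓘(ℝ, E) p) :
    secondFundamentalFormAt E E' F p u (a • v) = a • secondFundamentalFormAt E E' F p u v := by
  rw [secondFundamentalFormAt_comm hF, secondFundamentalFormAt_smul_left,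
    secondFundamentalFormAt_comm hF v]

theorem inner_secondFundamentalFormAt_swap (hF : IsIsometricImmersion E E' F)
    (u v w : TangentSpace 𝓘(ℝ, E) p) :
    (inner ℝ (secondFundamentalFormAt E E' F p u v) (mfderiv 𝓘(ℝ, E) 𝓘(ℝ, E') F p w) : ℝ) =
      -inner ℝ (secondFundamentalFormAt E E' F p u w) (mfderiv 𝓘(ℝ, E) 𝓘(ℝ, E') F p v) := by
  have hFp := hF.contMDiff.contMDiffAt (x := p)
  have hv := contMDiffAt_extend (k := ∞) 𝓘(ℝ, E) E v
  have hw := contMDiffAt_extend (k := ∞) 𝓘(ℝ, E) E w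
  have hv' := hv.mdifferentiableAt (by simp)
  have hw' := hw.mdifferentiableAt (by simp)
  have hmetric := covAlong_metric (contMDiffAt_mfderiv_apply hFp hv)
    (contMDiffAt_mfderiv_apply hFp hw) u
  simp only [hF.inner_map] at hmetric
  have hmetricM := leviCivita_metric (mdifferentiableAt_extend 𝓘(ℝ, E) E u) hv' hw'
  rw [extend_apply_self] at hmetricM
  rw [hmetricM, covAlong_mfderiv hFp hv', covAlong_mfderiv hFp hw'] at hmetric
  simp only [extend_apply_self, inner_add_left, inner_add_right, hF.inner_map] at hmetric
  rw [real_inner_comm (secondFundamentalFormAt E E' F p u w)] at hmetric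
  linarith

theorem inner_secondFundamentalFormAt_mfderiv (hF : IsIsometricImmersion E E' F)
    (u v w : TangentSpace 𝓘(ℝ, E) p) :
    (inner ℝ (secondFundamentalFormAt E E' F p u v) (mfderiv 𝓘(ℝ, E) 𝓘(ℝ, E') F p w) : ℝ) = 0 := by
  have hFp := hF.contMDiff.contMDiffAt (x := p)
  have huvw := inner_secondFundamentalFormAt_swap hF u v w
  have hvwu := inner_secondFundamentalFormAt_swap hF v w u
  have hwuv := inner_secondFundamentalFormAt_swap hF w u v
  rw [secondFundamentalFormAt_comm hFp v u] at hvwu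
  rw [secondFundamentalFormAt_comm hFp w u, secondFundamentalFormAt_comm hFp w v] at hwuv
  linarith

theorem inner_mfderiv_secondFundamentalFormAt (hF : IsIsometricImmersion E E' F)
    (u v w : TangentSpace 𝓘(ℝ, E) p) :
    (inner ℝ (mfderiv 𝓘(ℝ, E) 𝓘(ℝ, E') F p w) (secondFundamentalFormAt E E' F p u v) : ℝ) = 0 := by
  rw [real_inner_comm, inner_secondFundamentalFormAt_mfderiv hF]

theorem smoothAlongAt_secondFundamentalFormAt (hF : ContMDiff 𝓘(ℝ, E) 𝓘(ℝ, E') ∞ F)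
    {X Y : Π x : M, TangentSpace 𝓘(ℝ, E) x} (hX : CMDiffAt ∞ (T% X) p)
    (hY : CMDiffAt ∞ (T% Y) p) :
    SmoothAlongAt E F (fun x ↦ secondFundamentalFormAt E E' F x (X x) (Y x)) p := by
  refine ((smoothAlongAt_covAlong (contMDiffAt_mfderiv_apply (hF p) hY) hX).sub
    (contMDiffAt_mfderiv_apply (hF p) (contMDiffAt_leviCivita hX hY))).congr ?_
  filter_upwards [eventually_mdifferentiableAt hY] with x hx
  exact secondFundamentalForm_eq_at (hF x) X hx

end SecondFundamentalForm

section Algebra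

variable {V : Type*} [NormedAddCommGroup V] [InnerProductSpace ℝ V] [FiniteDimensional ℝ V]

theorem eq_zero_of_isSymmetric_of_trace_mul_self {T : V →ₗ[ℝ] V} (hT : T.IsSymmetric)
    (htrace : LinearMap.trace ℝ V (T * T) = 0) : T = 0 := by
  let b := stdOrthonormalBasis ℝ V
  have hsum : ∑ i, (inner ℝ (T (b i)) (T (b i)) : ℝ) = 0 := by
    simpa only [LinearMap.trace_eq_sum_inner _ b, Module.End.mul_apply, ← hT _ _] using htrace
  refine b.toBasis.ext fun i ↦ ?_
  simpa using (Finset.sum_eq_zero_iff_of_nonneg fun i _ ↦ real_inner_self_nonneg).1 hsum i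
    (Finset.mem_univ i)

theorem eq_zero_of_isSymmetric_of_commute {S : V →ₗ[ℝ] V →ₗ[ℝ] V}
    (hcomm : ∀ u v, S u v = S v u) (hsymm : ∀ u, (S u).IsSymmetric)
    (hcommute : ∀ u v, Commute (S u) (S v)) (htrace : ∀ u, LinearMap.trace ℝ V (S u) = 0) :
    S = 0 := by
  refine LinearMap.ext fun u ↦ eq_zero_of_isSymmetric_of_trace_mul_self (hsymm u) ?_
  have hsquare : S u * S u = S (S u u) := LinearMap.ext fun v ↦
    calc S u (S u v) = S u (S v u) := by rw [hcomm u v]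
      _ = S v (S u u) := LinearMap.congr_fun (hcommute u v) u
      _ = S (S u u) v := hcomm v _
  rw [hsquare, htrace]

end Algebra

/-! ### Totally real submanifolds -/

section Complex

variable {E : Type*} [NormedAddCommGroup E] [NormedSpace ℝ E]
  {M : Type*} [TopologicalSpace M] [ChartedSpace E M]
  {E' : Type*} [NormedAddCommGroup E'] [NormedSpace ℝ E']
  {N : Type*} [TopologicalSpace N] [ChartedSpace E' N]
  [RiemannianBundle (fun y : N ↦ TangentSpace 𝓘(ℝ, E') y)]
  {F : M → N} {J : Π y : N, TangentSpace 𝓘(ℝ, E') y →L[ℝ] TangentSpace 𝓘(ℝ, E') y}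
  {p : M}

variable (E E' F J p) in
/-- The map `u ↦ J (dF u)`, which for a totally real immersion embeds the tangent space of `M`
isometrically into the normal space. -/
def complexMfderiv : TangentSpace 𝓘(ℝ, E) p →L[ℝ] TangentSpace 𝓘(ℝ, E') (F p) :=
  J (F p) ∘L mfderiv 𝓘(ℝ, E) 𝓘(ℝ, E') F p

theorem IsTotallyReal.inner_mfderiv_complexMfderiv (hreal : IsTotallyReal E E' F J)
    (u v : TangentSpace 𝓘(ℝ, E) p) :
    (inner ℝ (mfderiv 𝓘(ℝ, E) 𝓘(ℝ, E') F p u) (complexMfderiv E E' F J p v) : ℝ) = 0 := by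
  rw [real_inner_comm]
  exact hreal p v u

variable [FiniteDimensional ℝ E'] [IsManifold 𝓘(ℝ, E') ∞ N]
  [IsContMDiffRiemannianBundle 𝓘(ℝ, E') ∞ E' (fun y : N ↦ TangentSpace 𝓘(ℝ, E') y)]

theorem eq_zero_of_complexMfderiv_eq_zero
    [RiemannianBundle (fun x : M ↦ TangentSpace 𝓘(ℝ, E) x)] (hJ : IsKahler J)
    (hF : IsIsometricImmersion E E' F) {u : TangentSpace 𝓘(ℝ, E) p}
    (hu : complexMfderiv E E' F J p u = 0) : u = 0 := by
  refine (inner_self_eq_zero (𝕜 := ℝ)).1 ?_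
  rw [← hF.inner_map, ← hJ.inner_map]
  exact inner_self_eq_zero.2 hu

variable [IsManifold 𝓘(ℝ, E) ∞ M] {Y : Π x : M, TangentSpace 𝓘(ℝ, E) x}

theorem smoothAlongAt_complexMfderiv (hJ : IsKahler J) (hF : ContMDiffAt 𝓘(ℝ, E) 𝓘(ℝ, E') ∞ F p)
    (hY : CMDiffAt ∞ (T% Y) p) :
    SmoothAlongAt E F (fun x ↦ complexMfderiv E E' F J x (Y x)) p :=
  hJ.smoothAlongAt (contMDiffAt_mfderiv_apply hF hY)

theorem IsTotallyReal.isNormalField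
    [RiemannianBundle (fun x : M ↦ TangentSpace 𝓘(ℝ, E) x)]
    (hreal : IsTotallyReal E E' F J) (hJ : IsKahler J) (hF : ContMDiff 𝓘(ℝ, E) 𝓘(ℝ, E') ∞ F)
    (hY : ContMDiff 𝓘(ℝ, E) (𝓘(ℝ, E).prod 𝓘(ℝ, E)) ∞ (T% Y)) :
    IsNormalField E E' F (fun x ↦ complexMfderiv E E' F J x (Y x)) where
  contMDiff p := smoothAlongAt_complexMfderiv hJ (hF p) (hY p)
  normal _ u := hreal.inner_mfderiv_complexMfderiv u _

end Complex

section NormalSpace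

variable {E : Type*} [NormedAddCommGroup E] [NormedSpace ℝ E] [FiniteDimensional ℝ E]
  {M : Type*} [TopologicalSpace M] [ChartedSpace E M]
  [RiemannianBundle (fun x : M ↦ TangentSpace 𝓘(ℝ, E) x)]
  {E' : Type*} [NormedAddCommGroup E'] [NormedSpace ℝ E'] [FiniteDimensional ℝ E']
  {N : Type*} [TopologicalSpace N] [ChartedSpace E' N]
  [RiemannianBundle (fun y : N ↦ TangentSpace 𝓘(ℝ, E') y)]
  {F : M → N} {J : Π y : N, TangentSpace 𝓘(ℝ, E') y →L[ℝ] TangentSpace 𝓘(ℝ, E') y}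
  {p : M}

theorem inner_normalPart_left (v : TangentSpace 𝓘(ℝ, E') (F p))
    {ξ : TangentSpace 𝓘(ℝ, E') (F p)}
    (hξ : ∀ u : TangentSpace 𝓘(ℝ, E) p, (inner ℝ (mfderiv 𝓘(ℝ, E) 𝓘(ℝ, E') F p u) ξ : ℝ) = 0) :
    (inner ℝ (normalPart E E' F p v) ξ : ℝ) = inner ℝ v ξ := by
  simp [normalPart, inner_sub_left, hξ]

variable (E E' F J p) in
/-- The operator `t` in the decomposition `J ξ = t ξ + f ξ` into tangential and normal parts. -/
def tStructure : TangentSpace 𝓘(ℝ, E') (F p) →L[ℝ] TangentSpace 𝓘(ℝ, E) p :=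
  tangentPart E E' F p ∘L J (F p)

theorem mfderiv_tStructure_add_fStructure (ξ : TangentSpace 𝓘(ℝ, E') (F p)) :
    mfderiv 𝓘(ℝ, E) 𝓘(ℝ, E') F p (tStructure E E' F J p ξ) + fStructure E E' F J p ξ
      = J (F p) ξ := by
  simp [tStructure, fStructure, normalPart]

variable [IsManifold 𝓘(ℝ, E') ∞ N]

theorem normalPart_mfderiv (hF : IsIsometricImmersion E E' F) (u : TangentSpace 𝓘(ℝ, E) p) :
    normalPart E E' F p (mfderiv 𝓘(ℝ, E) 𝓘(ℝ, E') F p u) = 0 := by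
  simp [normalPart, tangentPart_mfderiv E E' hF]

theorem normalPart_eq_self {ξ : TangentSpace 𝓘(ℝ, E') (F p)}
    (hξ : ∀ u : TangentSpace 𝓘(ℝ, E) p, (inner ℝ (mfderiv 𝓘(ℝ, E) 𝓘(ℝ, E') F p u) ξ : ℝ) = 0) :
    normalPart E E' F p ξ = ξ := by
  simp [normalPart, tangentPart_eq_zero E E' F p ξ hξ]

variable [IsContMDiffRiemannianBundle 𝓘(ℝ, E') ∞ E' (fun y : N ↦ TangentSpace 𝓘(ℝ, E') y)]

theorem inner_tStructure_left (hJ : IsKahler J) (ξ : TangentSpace 𝓘(ℝ, E') (F p))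
    (w : TangentSpace 𝓘(ℝ, E) p) :
    (inner ℝ (tStructure E E' F J p ξ) w : ℝ) = -inner ℝ ξ (complexMfderiv E E' F J p w) := by
  rw [tStructure, ContinuousLinearMap.comp_apply, tangentPart,
    ContinuousLinearMap.adjoint_inner_left, hJ.inner_left]
  rfl

theorem inner_fStructure_left (hJ : IsKahler J) {ξ η : TangentSpace 𝓘(ℝ, E') (F p)}
    (hξ : ∀ u : TangentSpace 𝓘(ℝ, E) p, (inner ℝ (mfderiv 𝓘(ℝ, E) 𝓘(ℝ, E') F p u) ξ : ℝ) = 0)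
    (hη : ∀ u : TangentSpace 𝓘(ℝ, E) p, (inner ℝ (mfderiv 𝓘(ℝ, E) 𝓘(ℝ, E') F p u) η : ℝ) = 0) :
    (inner ℝ (fStructure E E' F J p ξ) η : ℝ) = -inner ℝ ξ (fStructure E E' F J p η) := by
  calc (inner ℝ (fStructure E E' F J p ξ) η : ℝ)
      = inner ℝ (J (F p) ξ) η := inner_normalPart_left _ hη
    _ = -inner ℝ (J (F p) η) ξ := by rw [hJ.inner_left, real_inner_comm]
    _ = -inner ℝ (fStructure E E' F J p η) ξ := by rw [← inner_normalPart_left _ hξ]; rfl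
    _ = -inner ℝ ξ (fStructure E E' F J p η) := by rw [real_inner_comm]

theorem fStructure_eq_zero_of_sq_eq_zero (hJ : IsKahler J) (hF : IsIsometricImmersion E E' F)
    {ξ : TangentSpace 𝓘(ℝ, E') (F p)}
    (hξ : ∀ u : TangentSpace 𝓘(ℝ, E) p, (inner ℝ (mfderiv 𝓘(ℝ, E) 𝓘(ℝ, E') F p u) ξ : ℝ) = 0)
    (hsq : fStructure E E' F J p (fStructure E E' F J p ξ) = 0) :
    fStructure E E' F J p ξ = 0 := by
  refine (inner_self_eq_zero (𝕜 := ℝ)).1 ?_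
  rw [inner_fStructure_left (η := fStructure E E' F J p ξ) hJ hξ
    fun u ↦ inner_normalPart E E' hF p u _, hsq, inner_zero_right, neg_zero]

theorem fStructure_complexMfderiv (hJ : IsKahler J) (hF : IsIsometricImmersion E E' F)
    (u : TangentSpace 𝓘(ℝ, E) p) :
    fStructure E E' F J p (complexMfderiv E E' F J p u) = 0 := by
  rw [fStructure, complexMfderiv, ContinuousLinearMap.comp_apply, ContinuousLinearMap.comp_apply,
    hJ.sq, map_neg, normalPart_mfderiv hF, neg_zero]

theorem complexMfderiv_neg_tStructure (hJ : IsKahler J) {ξ : TangentSpace 𝓘(ℝ, E') (F p)}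
    (hξ : fStructure E E' F J p ξ = 0) :
    complexMfderiv E E' F J p (-tStructure E E' F J p ξ) = ξ := by
  have hJξ := mfderiv_tStructure_add_fStructure (E := E) (J := J) ξ
  rw [hξ, add_zero] at hJξ
  rw [complexMfderiv, ContinuousLinearMap.comp_apply, map_neg, map_neg, hJξ, hJ.sq, neg_neg]

end NormalSpace

section TotallyReal

variable {E : Type*} [NormedAddCommGroup E] [NormedSpace ℝ E] [FiniteDimensional ℝ E]
  {M : Type*} [TopologicalSpace M] [ChartedSpace E M] [IsManifold 𝓘(ℝ, E) ∞ M]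
  [RiemannianBundle (fun x : M ↦ TangentSpace 𝓘(ℝ, E) x)]
  [IsContMDiffRiemannianBundle 𝓘(ℝ, E) ∞ E (fun x : M ↦ TangentSpace 𝓘(ℝ, E) x)]
  {E' : Type*} [NormedAddCommGroup E'] [NormedSpace ℝ E'] [FiniteDimensional ℝ E']
  {N : Type*} [TopologicalSpace N] [ChartedSpace E' N] [IsManifold 𝓘(ℝ, E') ∞ N]
  [RiemannianBundle (fun y : N ↦ TangentSpace 𝓘(ℝ, E') y)]
  [IsContMDiffRiemannianBundle 𝓘(ℝ, E') ∞ E' (fun y : N ↦ TangentSpace 𝓘(ℝ, E') y)]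
  {F : M → N} {J : Π y : N, TangentSpace 𝓘(ℝ, E') y →L[ℝ] TangentSpace 𝓘(ℝ, E') y}
  {p : M} {Y : Π x : M, TangentSpace 𝓘(ℝ, E) x}

theorem covAlong_complexMfderiv (hJ : IsKahler J) (hF : ContMDiffAt 𝓘(ℝ, E) 𝓘(ℝ, E') ∞ F p)
    (hY : CMDiffAt ∞ (T% Y) p) (u : TangentSpace 𝓘(ℝ, E) p) :
    covAlong E E' F (fun x ↦ complexMfderiv E E' F J x (Y x)) p u =
      complexMfderiv E E' F J p (leviCivita Y p u)
        + J (F p) (secondFundamentalFormAt E E' F p u (Y p)) := by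
  simp only [complexMfderiv, ContinuousLinearMap.comp_apply]
  rw [hJ.covAlong_apply (contMDiffAt_mfderiv_apply hF hY),
    covAlong_mfderiv hF (hY.mdifferentiableAt (by simp)), map_add]

theorem normalDeriv_complexMfderiv (hJ : IsKahler J) (hF : ContMDiffAt 𝓘(ℝ, E) 𝓘(ℝ, E') ∞ F p)
    (hreal : IsTotallyReal E E' F J) (hY : CMDiffAt ∞ (T% Y) p) (u : TangentSpace 𝓘(ℝ, E) p) :
    normalDeriv E E' F (fun x ↦ complexMfderiv E E' F J x (Y x)) p u =
      complexMfderiv E E' F J p (leviCivita Y p u)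
        + fStructure E E' F J p (secondFundamentalFormAt E E' F p u (Y p)) := by
  rw [normalDeriv, ContinuousLinearMap.comp_apply, covAlong_complexMfderiv hJ hF hY, map_add,
    normalPart_eq_self fun w ↦ hreal.inner_mfderiv_complexMfderiv w _]
  rfl

theorem shapeOperator_complexMfderiv (hJ : IsKahler J) (hF : ContMDiffAt 𝓘(ℝ, E) 𝓘(ℝ, E') ∞ F p)
    (hreal : IsTotallyReal E E' F J) (hY : CMDiffAt ∞ (T% Y) p) (u : TangentSpace 𝓘(ℝ, E) p) :
    shapeOperator E E' F (fun x ↦ complexMfderiv E E' F J x (Y x)) p u =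
      -tStructure E E' F J p (secondFundamentalFormAt E E' F p u (Y p)) := by
  rw [shapeOperator, neg_apply, ContinuousLinearMap.comp_apply, covAlong_complexMfderiv hJ hF hY,
    map_add, tangentPart_eq_zero E E' F p _ fun w ↦ hreal.inner_mfderiv_complexMfderiv w _,
    zero_add]
  rfl

theorem fStructure_secondFundamentalFormAt [T2Space M] (hJ : IsKahler J)
    (hF : IsIsometricImmersion E E' F) (hreal : IsTotallyReal E E' F J)
    (hf : HasParallelFStructure E E' F J) (u v : TangentSpace 𝓘(ℝ, E) p) :
    fStructure E E' F J p (secondFundamentalFormAt E E' F p u v) = 0 := by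
  refine fStructure_eq_zero_of_sq_eq_zero hJ hF
    (inner_mfderiv_secondFundamentalFormAt hF u v) ?_
  obtain ⟨Y, hY, rfl⟩ := exists_contMDiff_apply_eq v
  -- `f` kills `J Y`, so its parallelism says that `f` also kills `D_u (J Y)`.
  have hparallel := hf _ (hreal.isNormalField hJ hF.contMDiff hY) p u
  simp only [fStructure_complexMfderiv hJ hF] at hparallel
  rw [normalDeriv, covAlong_zero ((hF.contMDiff p).mdifferentiableAt (by simp)),
    ContinuousLinearMap.comp_zero, normalDeriv_complexMfderiv hJ (hF.contMDiff p) hreal (hY p),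
    map_add, fStructure_complexMfderiv hJ hF, zero_add] at hparallel
  exact hparallel.symm

section ShapeProduct

variable (J) in
/-- The product `(u, v) ↦ -t σ(u, v)` on the tangent space, which is `A_{J v} u` for a totally real
immersion. -/
def shapeProduct (hF : ContMDiff 𝓘(ℝ, E) 𝓘(ℝ, E') ∞ F) (p : M) :
    TangentSpace 𝓘(ℝ, E) p →ₗ[ℝ] TangentSpace 𝓘(ℝ, E) p →ₗ[ℝ] TangentSpace 𝓘(ℝ, E) p :=
  LinearMap.mk₂ ℝ (fun u v ↦ -tStructure E E' F J p (secondFundamentalFormAt E E' F p u v))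
    (fun u u' v ↦ by rw [secondFundamentalFormAt_add_left, map_add, neg_add])
    (fun a u v ↦ by rw [secondFundamentalFormAt_smul_left, map_smul, smul_neg])
    (fun u v v' ↦ by rw [secondFundamentalFormAt_add_right (hF p), map_add, neg_add])
    (fun a u v ↦ by rw [secondFundamentalFormAt_smul_right (hF p), map_smul, smul_neg])

theorem shapeProduct_apply (hF : ContMDiff 𝓘(ℝ, E) 𝓘(ℝ, E') ∞ F) (u v : TangentSpace 𝓘(ℝ, E) p) :
    shapeProduct J hF p u v =
      -tStructure E E' F J p (secondFundamentalFormAt E E' F p u v) := rfl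

theorem shapeProduct_comm (hF : ContMDiff 𝓘(ℝ, E) 𝓘(ℝ, E') ∞ F) (u v : TangentSpace 𝓘(ℝ, E) p) :
    shapeProduct J hF p u v = shapeProduct J hF p v u := by
  rw [shapeProduct_apply, shapeProduct_apply, secondFundamentalFormAt_comm (hF p)]

theorem inner_shapeProduct (hJ : IsKahler J) (hF : ContMDiff 𝓘(ℝ, E) 𝓘(ℝ, E') ∞ F)
    (u v w : TangentSpace 𝓘(ℝ, E) p) :
    (inner ℝ (shapeProduct J hF p u v) w : ℝ) =
      inner ℝ (secondFundamentalFormAt E E' F p u v) (complexMfderiv E E' F J p w) := by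
  rw [shapeProduct_apply, inner_neg_left, inner_tStructure_left hJ, neg_neg]

theorem isSymmetric_shapeProduct (hJ : IsKahler J) (hF : IsIsometricImmersion E E' F)
    (hreal : IsTotallyReal E E' F J) (u : TangentSpace 𝓘(ℝ, E) p) :
    (shapeProduct J hF.contMDiff p u).IsSymmetric := by
  intro v w
  have hFp := hF.contMDiff.contMDiffAt (x := p)
  have hv := contMDiffAt_extend (k := ∞) 𝓘(ℝ, E) E v
  have hw := contMDiffAt_extend (k := ∞) 𝓘(ℝ, E) E w
  -- Differentiate `⟨dF V, J dF W⟩ = 0` along `u`, for extensions `V`, `W` of `v`, `w`.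
  have hmetric := covAlong_metric (contMDiffAt_mfderiv_apply hFp hv)
    (smoothAlongAt_complexMfderiv hJ hFp hw) u
  simp only [hreal.inner_mfderiv_complexMfderiv] at hmetric
  rw [mvfderiv_const, zero_apply, covAlong_complexMfderiv hJ hFp hw,
    covAlong_mfderiv hFp (hv.mdifferentiableAt (by simp))] at hmetric
  simp only [extend_apply_self, inner_add_left, inner_add_right,
    hreal.inner_mfderiv_complexMfderiv, zero_add] at hmetric
  have hswap : (inner ℝ (mfderiv 𝓘(ℝ, E) 𝓘(ℝ, E') F p v)
      (J (F p) (secondFundamentalFormAt E E' F p u w)) : ℝ) =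
      -inner ℝ (secondFundamentalFormAt E E' F p u w) (complexMfderiv E E' F J p v) := by
    rw [real_inner_comm, hJ.inner_left]
    rfl
  rw [real_inner_comm (shapeProduct J hF.contMDiff p u w), inner_shapeProduct hJ,
    inner_shapeProduct hJ]
  linarith

theorem commute_shapeProduct [T2Space M] (hJ : IsKahler J) (hF : ContMDiff 𝓘(ℝ, E) 𝓘(ℝ, E') ∞ F)
    (hreal : IsTotallyReal E E' F J) (hcomm : HasCommutativeSecondFundamentalForms E E' F)
    (u v : TangentSpace 𝓘(ℝ, E) p) :
    Commute (shapeProduct J hF p u) (shapeProduct J hF p v) := by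
  obtain ⟨Y, hY, rfl⟩ := exists_contMDiff_apply_eq u
  obtain ⟨Z, hZ, rfl⟩ := exists_contMDiff_apply_eq v
  have hshape : ∀ {W : Π x : M, TangentSpace 𝓘(ℝ, E) x}, CMDiffAt ∞ (T% W) p → ∀ w,
      shapeOperator E E' F (fun x ↦ complexMfderiv E E' F J x (W x)) p w =
        shapeProduct J hF p (W p) w := fun hW w ↦ by
    rw [shapeOperator_complexMfderiv hJ (hF p) hreal hW, shapeProduct_comm, shapeProduct_apply]
  refine LinearMap.ext fun w ↦ ?_
  simpa only [ContinuousLinearMap.comp_apply, Module.End.mul_apply, hshape (hY p),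
    hshape (hZ p)] using congrArg (fun L ↦ L w)
      (hcomm _ _ (hreal.isNormalField hJ hF hY) (hreal.isNormalField hJ hF hZ) p)

theorem contMDiffAt_shapeProduct (hJ : IsKahler J) (hF : ContMDiff 𝓘(ℝ, E) 𝓘(ℝ, E') ∞ F)
    {X : Π x : M, TangentSpace 𝓘(ℝ, E) x} (hX : CMDiffAt ∞ (T% X) p)
    (hY : CMDiffAt ∞ (T% Y) p) :
    CMDiffAt ∞ (T% (fun x ↦ shapeProduct J hF x (X x) (Y x))) p := by
  refine contMDiffAt_of_inner fun Z hZ ↦ ?_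
  simp only [real_inner_comm (shapeProduct J hF _ _ _), inner_shapeProduct hJ]
  exact (smoothAlongAt_secondFundamentalFormAt hF hX hY).contMDiffAt_inner
    (smoothAlongAt_complexMfderiv hJ (hF p) hZ)

theorem isTotallyGeodesic_of_shapeProduct_eq_zero [T2Space M] (hJ : IsKahler J)
    (hF : IsIsometricImmersion E E' F) (hreal : IsTotallyReal E E' F J)
    (hf : HasParallelFStructure E E' F J) (hzero : ∀ p, shapeProduct J hF.contMDiff p = 0) :
    IsTotallyGeodesic E E' F := fun p u v ↦ by
  rw [← complexMfderiv_neg_tStructure hJ (fStructure_secondFundamentalFormAt hJ hF hreal hf u v),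
    ← shapeProduct_apply hF.contMDiff, hzero, LinearMap.zero_apply, LinearMap.zero_apply, map_zero]

end ShapeProduct

section MeanCurvature

variable (E E' F J) in
/-- The tangent vector field `-t H`, so that `H` is the image of this field under `J` when
`f H = 0`. -/
def meanCurvatureField (p : M) : TangentSpace 𝓘(ℝ, E) p :=
  -tStructure E E' F J p (meanCurvature E E' F p)

theorem complexMfderiv_meanCurvatureField [T2Space M] (hJ : IsKahler J)
    (hF : IsIsometricImmersion E E' F) (hreal : IsTotallyReal E E' F J)
    (hf : HasParallelFStructure E E' F J) (p : M) :
    complexMfderiv E E' F J p (meanCurvatureField E E' F J p) = meanCurvature E E' F p := by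
  refine complexMfderiv_neg_tStructure hJ ?_
  simp only [meanCurvature, map_smul, map_sum, fStructure_secondFundamentalFormAt hJ hF hreal hf,
    Finset.sum_const_zero, smul_zero]

theorem inner_meanCurvatureField (hJ : IsKahler J) (hF : IsIsometricImmersion E E' F)
    (hreal : IsTotallyReal E E' F J) (w : TangentSpace 𝓘(ℝ, E) p) :
    (inner ℝ (meanCurvatureField E E' F J p) w : ℝ) = (Module.finrank ℝ E : ℝ)⁻¹ *
      LinearMap.trace ℝ (TangentSpace 𝓘(ℝ, E) p) (shapeProduct J hF.contMDiff p w) := by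
  let b := stdOrthonormalBasis ℝ (TangentSpace 𝓘(ℝ, E) p)
  have hfield : meanCurvatureField E E' F J p =
      (Module.finrank ℝ E : ℝ)⁻¹ • ∑ i, shapeProduct J hF.contMDiff p (b i) (b i) := by
    simp only [meanCurvatureField, meanCurvature, shapeProduct_apply, map_smul, map_sum,
      Finset.sum_neg_distrib, smul_neg, b]
  rw [hfield, real_inner_smul_left, sum_inner, LinearMap.trace_eq_sum_inner _ b]
  congr 1
  refine Finset.sum_congr rfl fun i _ ↦ ?_
  rw [isSymmetric_shapeProduct hJ hF hreal, shapeProduct_comm]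

theorem contMDiffAt_meanCurvatureField (hJ : IsKahler J) (hF : IsIsometricImmersion E E' F)
    (hreal : IsTotallyReal E E' F J) :
    CMDiffAt ∞ (T% (meanCurvatureField E E' F J)) p := by
  refine contMDiffAt_of_inner fun Z hZ ↦ ?_
  simp only [real_inner_comm (meanCurvatureField E E' F J _), inner_meanCurvatureField hJ hF hreal]
  exact contMDiffAt_const.mul
    (contMDiffAt_trace fun W hW ↦ contMDiffAt_shapeProduct hJ hF.contMDiff hZ hW)

theorem isParallel_meanCurvatureField [T2Space M] (hJ : IsKahler J)
    (hF : IsIsometricImmersion E E' F) (hreal : IsTotallyReal E E' F J)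
    (hf : HasParallelFStructure E E' F J) (hH : HasParallelMeanCurvature E E' F) :
    IsParallel (meanCurvatureField E E' F J) where
  contMDiffAt p := contMDiffAt_meanCurvatureField hJ hF hreal
  leviCivita_eq_zero p := by
    ext u
    refine eq_zero_of_complexMfderiv_eq_zero hJ hF ?_
    have hparallel := hH p u
    rwa [← funext (complexMfderiv_meanCurvatureField hJ hF hreal hf),
      normalDeriv_complexMfderiv hJ (hF.contMDiff p) hreal
        (contMDiffAt_meanCurvatureField hJ hF hreal),
      fStructure_secondFundamentalFormAt hJ hF hreal hf, add_zero] at hparallel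

theorem trace_shapeProduct_eq_zero (hJ : IsKahler J) (hF : IsIsometricImmersion E E' F)
    (hreal : IsTotallyReal E E' F J) (hp : meanCurvatureField E E' F J p = 0)
    (u : TangentSpace 𝓘(ℝ, E) p) :
    LinearMap.trace ℝ (TangentSpace 𝓘(ℝ, E) p) (shapeProduct J hF.contMDiff p u) = 0 := by
  have hinner := inner_meanCurvatureField hJ hF hreal u
  rw [hp, inner_zero_left, eq_comm, mul_eq_zero, inv_eq_zero, Nat.cast_eq_zero] at hinner
  rcases hinner with hdim | htrace
  · have : Subsingleton (TangentSpace 𝓘(ℝ, E) p) :=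
      (Module.finrank_zero_iff (R := ℝ) (M := E)).1 hdim
    rw [Subsingleton.elim (shapeProduct J hF.contMDiff p u) 0, map_zero]
  · exact htrace

end MeanCurvature

end TotallyReal

end

end TotReal

theorem proposition4_general
    {E' : Type*} [NormedAddCommGroup E'] [NormedSpace ℝ E'] [FiniteDimensional ℝ E']
    {N : Type*} [TopologicalSpace N] [ChartedSpace E' N] [IsManifold 𝓘(ℝ, E') ∞ N]
    [RiemannianBundle (fun y : N ↦ TangentSpace 𝓘(ℝ, E') y)]
    [IsContMDiffRiemannianBundle 𝓘(ℝ, E') ∞ E' (fun y : N ↦ TangentSpace 𝓘(ℝ, E') y)]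
    {J : Π y : N, TangentSpace 𝓘(ℝ, E') y →L[ℝ] TangentSpace 𝓘(ℝ, E') y}
    (hJ : TotReal.IsKahler J)
    {E : Type*} [NormedAddCommGroup E] [NormedSpace ℝ E] [FiniteDimensional ℝ E]
    {M : Type*} [TopologicalSpace M] [T2Space M] [PreconnectedSpace M] [ChartedSpace E M]
    [IsManifold 𝓘(ℝ, E) ∞ M]
    [RiemannianBundle (fun x : M ↦ TangentSpace 𝓘(ℝ, E) x)]
    [IsContMDiffRiemannianBundle 𝓘(ℝ, E) ∞ E (fun x : M ↦ TangentSpace 𝓘(ℝ, E) x)]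
    {F : M → N} (hF : TotReal.IsIsometricImmersion E E' F)
    (hreal : TotReal.IsTotallyReal E E' F J)
    (hcomm : TotReal.HasCommutativeSecondFundamentalForms E E' F)
    (hf : TotReal.HasParallelFStructure E E' F J)
    (hH : TotReal.HasParallelMeanCurvature E E' F) :
    (∃ h : Π x : M, TangentSpace 𝓘(ℝ, E) x, TotReal.IsParallel h ∧ ∀ p, h p ≠ 0) ∨
      TotReal.IsTotallyGeodesic E E' F := by
  have hpar := TotReal.isParallel_meanCurvatureField hJ hF hreal hf hH
  by_cases hne : ∀ p, TotReal.meanCurvatureField E E' F J p ≠ 0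
  · exact .inl ⟨_, hpar, hne⟩
  · push Not at hne
    obtain ⟨p, hp⟩ := hne
    refine .inr (TotReal.isTotallyGeodesic_of_shapeProduct_eq_zero hJ hF hreal hf fun q ↦ ?_)
    exact TotReal.eq_zero_of_isSymmetric_of_commute (TotReal.shapeProduct_comm hF.contMDiff)
      (TotReal.isSymmetric_shapeProduct hJ hF hreal)
      (TotReal.commute_shapeProduct hJ hF.contMDiff hreal hcomm)
      (TotReal.trace_shapeProduct_eq_zero hJ hF hreal (hpar.eq_zero_of_apply_eq_zero hp q))

theorem proposition4
    -- the ambient Kähler manifold `N`, with complex structure `J`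
    {E' : Type*} [NormedAddCommGroup E'] [NormedSpace ℝ E'] [FiniteDimensional ℝ E']
    {N : Type*} [TopologicalSpace N] [T2Space N] [ChartedSpace E' N] [IsManifold 𝓘(ℝ, E') ∞ N]
    [RiemannianBundle (fun y : N ↦ TangentSpace 𝓘(ℝ, E') y)]
    [IsContMDiffRiemannianBundle 𝓘(ℝ, E') ∞ E' (fun y : N ↦ TangentSpace 𝓘(ℝ, E') y)]
    (J : Π y : N, TangentSpace 𝓘(ℝ, E') y →L[ℝ] TangentSpace 𝓘(ℝ, E') y)
    (hJ : TotReal.IsKahler J)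
    -- the connected surface `M`, with the metric induced by the immersion `F`
    {E : Type*} [NormedAddCommGroup E] [NormedSpace ℝ E] [FiniteDimensional ℝ E]
    (hdim : Module.finrank ℝ E = 2)
    {M : Type*} [TopologicalSpace M] [T2Space M] [ConnectedSpace M] [ChartedSpace E M]
    [IsManifold 𝓘(ℝ, E) ∞ M]
    [RiemannianBundle (fun x : M ↦ TangentSpace 𝓘(ℝ, E) x)]
    [IsContMDiffRiemannianBundle 𝓘(ℝ, E) ∞ E (fun x : M ↦ TangentSpace 𝓘(ℝ, E) x)]
    (F : M → N) (hF : TotReal.IsIsometricImmersion E E' F)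
    (hreal : TotReal.IsTotallyReal E E' F J)
    (hcomm : TotReal.HasCommutativeSecondFundamentalForms E E' F)
    (hf : TotReal.HasParallelFStructure E E' F J)
    (hH : TotReal.HasParallelMeanCurvature E E' F) :
    TotReal.IsFlat E M ∨ TotReal.IsTotallyGeodesic E E' F :=
  (proposition4_general hJ hF hreal hcomm hf hH).imp_left fun ⟨_, hpar, hne⟩ ↦ hpar.isFlat hdim hne
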